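/- For real $a,b$ let $F_{ab}(x)=a$ if $x\ge 0$ and $F_{ab}(x)=b$ if $x<0$, let $T_{ab}:\mathbb R^2\to\mathbb R^2$ be the bijection $T_{ab}(x,y)=(F_{ab}(x)\,x-y,\;x)$, and let $S_{ab}(u)=T_{ab}(u)/|T_{ab}(u)|$ be the induced orientation-preserving homeomorphism of the unit circle $S^1\subset\mathbb R^2$. Orbits are two-sided: the orbit of $v$ under $T_{ab}$ is $\{T_{ab}^{(k)}(v):k\in\mathbb Z\}$, and similarly for $S_{ab}$. An invariant circle of $T_{ab}$ is a simple closed curve that surrounds the origin and is mapped onto itself by $T_{ab}$. Suppose that the rotation number of $S_{ab}$ (in turns) is irrational and that the $S_{ab}$-orbit of $(0,1)$ contains $(0,-1)$. Then: (1) The $T_{ab}$-orbit of $(0,1)$ contains $(0,-1)$. (2) For every nonzero $v\in\mathbb R^2$ the closure of the $T_{ab}$-orbit of $v$ is an invariant circle of $T_{ab}$, and it is a finite union of arcs of conic sections, any two of which meet at most in end points. All these arcs, for all $v$, are of one and the same type: either all are arcs of (nondegenerate) ellipses, or all are arcs of (nondegenerate) hyperbolas, or all are line segments. (3) If $n\in\mathbb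 Z$ and $S_{ab}^{(n)}(0,1)=(0,-1)$, then each of the invariant circles in (2) can be divided in this way into at most $|n|$ arcs. -/

import Mathlib

namespace PlaneMap

/-- The coefficient `F_{ab}(x)`: equal to `a` if `x ≥ 0` and to `b` if `x < 0`. -/
noncomputable def F (a b x : ℝ) : ℝ := if 0 ≤ x then a else b

/-- The piecewise linear bijection `T_{ab}(x, y) = (F_{ab}(x) x - y, x)` of the plane. -/
noncomputable def T (a b : ℝ) : Equiv.Perm (ℝ × ℝ) where
  toFun v := (F a b v.1 * v.1 - v.2, v.1)
  invFun v := (v.2, F a b v.2 * v.2 - v.1)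
  left_inv v := by ext <;> simp
  right_inv v := by ext <;> simp

/-- The Euclidean length of a vector of the plane (the norm of `ℝ × ℝ` is the sup norm). -/
noncomputable def len (v : ℝ × ℝ) : ℝ := Real.sqrt (v.1 ^ 2 + v.2 ^ 2)

/-- The unit circle `S¹` of the Euclidean plane. -/
abbrev UnitCircle : Type := {v : ℝ × ℝ // v.1 ^ 2 + v.2 ^ 2 = 1}

theorem sq_pos_of_ne {v : ℝ × ℝ} (hv : v ≠ 0) : 0 < v.1 ^ 2 + v.2 ^ 2 := by
  by_contra h
  apply hv
  have h1 : v.1 = 0 := by nlinarith [sq_nonneg v.1, sq_nonneg v.2]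
  have h2 : v.2 = 0 := by nlinarith [sq_nonneg v.1, sq_nonneg v.2]
  ext <;> simp [h1, h2]

theorem len_pos {v : ℝ × ℝ} (hv : v ≠ 0) : 0 < len v := Real.sqrt_pos.2 (sq_pos_of_ne hv)

theorem UnitCircle.ne_zero (u : UnitCircle) : (u : ℝ × ℝ) ≠ 0 := by
  intro h
  have := u.2
  simp [h] at this

/-- The radial projection `v / |v|` of a nonzero vector to the unit circle. -/
noncomputable def direction (v : ℝ × ℝ) (hv : v ≠ 0) : UnitCircle :=
  ⟨(len v)⁻¹ • v, by
    have h : len v ^ 2 = v.1 ^ 2 + v.2 ^ 2 := Real.sq_sqrt (sq_pos_of_ne hv).le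
    have h0 := (len_pos hv).ne'
    simp only [Prod.smul_fst, Prod.smul_snd, smul_eq_mul]
    field_simp
    exact h.symm⟩

theorem direction_smul (u : UnitCircle) {c : ℝ} (hc : 0 < c) (h : c • (u : ℝ × ℝ) ≠ 0) :
    direction (c • (u : ℝ × ℝ)) h = u := by
  have hl : len (c • (u : ℝ × ℝ)) = c := by
    have : (c * (u : ℝ × ℝ).1) ^ 2 + (c * (u : ℝ × ℝ).2) ^ 2 = c ^ 2 := by
      linear_combination c ^ 2 * u.2
    simp only [len, Prod.smul_fst, Prod.smul_snd, smul_eq_mul, this]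
    exact Real.sqrt_sq hc.le
  apply Subtype.ext
  change (len (c • (u : ℝ × ℝ)))⁻¹ • c • (u : ℝ × ℝ) = u
  rw [hl, smul_smul, inv_mul_cancel₀ hc.ne', one_smul]

theorem F_mul {a b c : ℝ} (hc : 0 < c) (x : ℝ) : F a b (c * x) = F a b x := by
  simp [F, mul_nonneg_iff_of_pos_left hc]

theorem T_smul (a b : ℝ) {c : ℝ} (hc : 0 < c) (v : ℝ × ℝ) : T a b (c • v) = c • T a b v := by
  ext <;> simp [T, F_mul hc]; ring

theorem T_symm_smul (a b : ℝ) {c : ℝ} (hc : 0 < c) (v : ℝ × ℝ) :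
    (T a b).symm (c • v) = c • (T a b).symm v := by
  rw [Equiv.symm_apply_eq, T_smul a b hc, Equiv.apply_symm_apply]

theorem T_ne_zero (a b : ℝ) {v : ℝ × ℝ} (hv : v ≠ 0) : T a b v ≠ 0 := by
  intro h
  have h1 : v.1 = 0 := congrArg Prod.snd h
  have h2 : F a b v.1 * v.1 - v.2 = 0 := congrArg Prod.fst h
  apply hv
  ext
  · exact h1
  · simpa [h1] using h2

theorem T_symm_ne_zero (a b : ℝ) {v : ℝ × ℝ} (hv : v ≠ 0) : (T a b).symm v ≠ 0 := by
  intro h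
  rw [Equiv.symm_apply_eq] at h
  exact hv (h.trans (by ext <;> simp [T]))

/-- The circle map `S_{ab}(u) = T_{ab}(u) / |T_{ab}(u)|`, a bijection of the unit circle with
inverse `u ↦ T_{ab}⁻¹(u) / |T_{ab}⁻¹(u)|`. -/
noncomputable def S (a b : ℝ) : Equiv.Perm UnitCircle where
  toFun u := direction (T a b u) (T_ne_zero a b u.ne_zero)
  invFun u := direction ((T a b).symm u) (T_symm_ne_zero a b u.ne_zero)
  left_inv u := by
    have hp := inv_pos.2 (len_pos (T_ne_zero a b u.ne_zero))
    have h : (T a b).symm (direction (T a b u) (T_ne_zero a b u.ne_zero) : ℝ × ℝ)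
        = (len (T a b u))⁻¹ • (u : ℝ × ℝ) := by
      change (T a b).symm ((len (T a b u))⁻¹ • T a b u) = _
      rw [T_symm_smul a b hp, Equiv.symm_apply_apply]
    simp only [h]
    exact direction_smul u hp _
  right_inv u := by
    have hp := inv_pos.2 (len_pos (T_symm_ne_zero a b u.ne_zero))
    have h : T a b (direction ((T a b).symm u) (T_symm_ne_zero a b u.ne_zero) : ℝ × ℝ)
        = (len ((T a b).symm u))⁻¹ • (u : ℝ × ℝ) := by
      change T a b ((len ((T a b).symm u))⁻¹ • (T a b).symm u) = _
      rw [T_smul a b hp, Equiv.apply_symm_apply]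
    simp only [h]
    exact direction_smul u hp _

/-- The point `(0, 1)` of the unit circle. -/
def north : UnitCircle := ⟨(0, 1), by norm_num⟩

/-- The point `(0, -1)` of the unit circle. -/
def south : UnitCircle := ⟨(0, -1), by norm_num⟩

/-- The point of the unit circle reached after `t` counterclockwise turns from `(1, 0)`. -/
noncomputable def turn (t : ℝ) : UnitCircle :=
  ⟨(Real.cos (2 * Real.pi * t), Real.sin (2 * Real.pi * t)), Real.cos_sq_add_sin_sq _⟩

/-- `r` is a rotation number of the circle map `g` (measured in turns, counterclockwise): it is
the translation number `lim Φⁿ(t) / n` of a continuous monotone lift `Φ : ℝ → ℝ`,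
`Φ(t + 1) = Φ(t) + 1`, of `g`. The rotation number is determined up to an integer. -/
def HasRotationNumber (g : UnitCircle → UnitCircle) (r : ℝ) : Prop :=
  ∃ Φ : CircleDeg1Lift, Continuous Φ ∧ (∀ t : ℝ, g (turn t) = turn (Φ t)) ∧
    Φ.translationNumber = r

/-- The two-sided orbit of `v` under a bijection of the plane. -/
def orbit (f : Equiv.Perm (ℝ × ℝ)) (v : ℝ × ℝ) : Set (ℝ × ℝ) :=
  Set.range fun k : ℤ => (f ^ k) v

/-- An invariant circle of `f`: a simple closed curve that surrounds the origin (the origin lies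
in a bounded component of its complement) and is mapped onto itself by `f`. -/
def IsInvariantCircle (f : Equiv.Perm (ℝ × ℝ)) (C : Set (ℝ × ℝ)) : Prop :=
  Nonempty (C ≃ₜ Circle) ∧
  (0 ∉ C ∧ Bornology.IsBounded (connectedComponentIn Cᶜ (0 : ℝ × ℝ))) ∧
  f '' C = C

/-- The zero set of `A x² + B x y + C y² + D x + E y + G` in the plane. -/
def quadric (A B C D E G : ℝ) : Set (ℝ × ℝ) :=
  {p | A * p.1 ^ 2 + B * p.1 * p.2 + C * p.2 ^ 2 + D * p.1 + E * p.2 + G = 0}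

/-- A (nondegenerate, real) ellipse; circles are ellipses. -/
def IsEllipse (K : Set (ℝ × ℝ)) : Prop :=
  ∃ A B C D E G : ℝ, B ^ 2 - 4 * A * C < 0 ∧ K = quadric A B C D E G ∧ K.Nontrivial

/-- A nondegenerate hyperbola. -/
def IsHyperbola (K : Set (ℝ × ℝ)) : Prop :=
  ∃ A B C D E G : ℝ, 0 < B ^ 2 - 4 * A * C ∧
    4 * A * C * G + B * D * E - A * E ^ 2 - C * D ^ 2 - B ^ 2 * G ≠ 0 ∧
    K = quadric A B C D E G

/-- A straight line. -/
def IsLine (K : Set (ℝ × ℝ)) : Prop :=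
  ∃ D E G : ℝ, (D ≠ 0 ∨ E ≠ 0) ∧ K = {p | D * p.1 + E * p.2 + G = 0}

/-- The three types of conic sections that occur. -/
inductive ConicType where
  | ellipse
  | hyperbola
  | line

/-- `K` is a conic section of the given type. -/
def ConicType.IsConic : ConicType → Set (ℝ × ℝ) → Prop
  | .ellipse, K => IsEllipse K
  | .hyperbola, K => IsHyperbola K
  | .line, K => IsLine K

/-- `C` is made of `m` arcs of conics of type `τ`: it is the union of the images of `m` injective
continuous paths `γ i : [0, 1] → ℝ²`, each running inside some conic of type `τ` (for lines these
images are line segments), and different arcs can only meet at their end points. -/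
def IsUnionOfConicArcs (τ : ConicType) (m : ℕ) (C : Set (ℝ × ℝ)) : Prop :=
  ∃ γ : Fin m → ℝ → ℝ × ℝ,
    (∀ i, ContinuousOn (γ i) (Set.Icc 0 1) ∧ Set.InjOn (γ i) (Set.Icc 0 1) ∧
      ∃ K, τ.IsConic K ∧ γ i '' Set.Icc 0 1 ⊆ K) ∧
    (∀ i j, i ≠ j → Disjoint (γ i '' Set.Ioo 0 1) (γ j '' Set.Icc 0 1)) ∧
    C = ⋃ i, γ i '' Set.Icc 0 1

end PlaneMap

namespace PlaneMap
open Filter Topology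

/-! `T` is homogeneous, preserves area, and is linear on each half plane; the two linear pieces
differ by shears along the rays through north and south. The idea is to change the linear structure
of the punctured plane so that `T` becomes linear. A cone structure is obtained by inserting shears
along finitely many rays; its developing map `c` lives on the line of angles and has holonomy `M`
over one turn. In these coordinates `T` is one symplectic map `A` as soon as the inserted shears
absorb the breaks of `T` (`IsDeveloping.exists_intertwining`).

Finitely many shears suffice exactly because one break is carried to the other. They are placed
along the orbit from `p` to `q` (north and south in some order), each being the image under `T` of
the preceding one. The absorption condition then telescopes (`sum_orbitBreak_eq`): only the ends
remain, and they match because the breaks at `p` and `q = -p` are opposite. This needs `T^n p = q`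
exactly and not only up to a positive factor, which is supplied by reversibility under exchange of
coordinates (`T_zpow_north`).

As `T` respects full turns, `A` commutes with `M`, so both preserve a common nonzero quadratic form:
`ω(v, Av)` or `ω(v, Mv)`, or `x² + y²` if both are scalar. Its zeros along `c` form a discrete set
of angles invariant under the circle map; without periodic points this set is empty. Up to sign, the
form therefore descends to a positive `T`-invariant function `N`, homogeneous of degree two
(`IsDeveloping.exists_isGauge`).

The level sets of `N` are invariant circles. Between consecutive inserted rays `c` is linear with
determinant one, so `N` is there a quadratic form whose discriminant is independent of the sector.
Hence the arcs are conics of one type, one per sector. Finally, sublevel sets of `N` have finite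
area, so Poincaré recurrence forbids a gap in an orbit closure of the circle map; orbits of
directions are dense, and each orbit of `T` is dense in its level set. -/

/-! ### The symplectic form and its linear automorphisms -/

/-- The oriented area spanned by two vectors of the plane. -/
def cross (u v : ℝ × ℝ) : ℝ := u.1 * v.2 - u.2 * v.1

/-- The group of area- and orientation-preserving linear automorphisms of the plane. -/
def Sp : Subgroup ((ℝ × ℝ) ≃ₗ[ℝ] (ℝ × ℝ)) where
  carrier := {B | ∀ u v, cross (B u) (B v) = cross u v}
  one_mem' _ _ := rfl
  mul_mem' {A B} hA hB u v := by
    simp only [Set.mem_ofPred_eq] at hA hB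
    rw [LinearEquiv.mul_apply, LinearEquiv.mul_apply, hA, hB]
  inv_mem' {A} hA u v := by
    have h := hA (A⁻¹ u) (A⁻¹ v)
    rw [← LinearEquiv.mul_apply, ← LinearEquiv.mul_apply, mul_inv_cancel] at h
    exact h.symm

theorem Sp.cross_smul_smul (B : Sp) (u v : ℝ × ℝ) : cross (B • u) (B • v) = cross u v :=
  B.2 u v

theorem Sp.smul_real_smul (B : Sp) (r : ℝ) (v : ℝ × ℝ) : B • r • v = r • B • v :=
  map_smul (B : (ℝ × ℝ) ≃ₗ[ℝ] (ℝ × ℝ)) r v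

theorem Sp.continuous_smul (B : Sp) : Continuous fun v : ℝ × ℝ => B • v :=
  (LinearMap.continuous_of_finiteDimensional
    ((B : (ℝ × ℝ) ≃ₗ[ℝ] (ℝ × ℝ)) : (ℝ × ℝ) →ₗ[ℝ] (ℝ × ℝ)))

theorem Sp.smul_eq (B : Sp) (v : ℝ × ℝ) :
    B • v = v.1 • B • ((1, 0) : ℝ × ℝ) + v.2 • B • ((0, 1) : ℝ × ℝ) := by
  rw [← Sp.smul_real_smul B, ← Sp.smul_real_smul B, ← smul_add]
  congr 1
  ext <;> simp

/-- Two vectors that span the plane determine a linear map. -/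
theorem Sp.ext_of_cross_ne_zero {A B : Sp} {u v : ℝ × ℝ} (h : cross u v ≠ 0)
    (hu : A • u = B • u) (hv : A • v = B • v) : A = B := by
  have key : ∀ w : ℝ × ℝ, w = (cross w v / cross u v) • u + (cross u w / cross u v) • v := by
    intro w
    ext <;> simp only [Prod.fst_add, Prod.snd_add, Prod.smul_fst, Prod.smul_snd, smul_eq_mul] <;>
      field_simp <;> simp only [cross] <;> ring
  apply Subtype.ext
  apply LinearEquiv.ext
  intro w
  change A • w = B • w
  rw [key w, smul_add, smul_add, Sp.smul_real_smul A, Sp.smul_real_smul A, Sp.smul_real_smul B,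
    Sp.smul_real_smul B, hu, hv]

/-- The shear `v ↦ v + s ω(u, v) u`, which fixes the line spanned by `u`. -/
def shear (s : ℝ) (u : ℝ × ℝ) : Sp :=
  ⟨{ toFun := fun v => v + (s * cross u v) • u
     invFun := fun v => v - (s * cross u v) • u
     map_add' := fun v w => by ext <;> simp [cross] <;> ring
     map_smul' := fun r v => by ext <;> simp [cross] <;> ring
     left_inv := fun v => by ext <;> simp [cross] <;> ring
     right_inv := fun v => by ext <;> simp [cross] <;> ring },
   fun v w => by simp [cross]; ring⟩

theorem shear_smul (s : ℝ) (u v : ℝ × ℝ) : shear s u • v = v + (s * cross u v) • u := rfl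

theorem shear_smul_self (s : ℝ) (u : ℝ × ℝ) : shear s u • u = u := by
  rw [shear_smul, show cross u u = 0 by rw [cross]; ring, mul_zero, zero_smul, add_zero]

theorem shear_zero (u : ℝ × ℝ) : shear 0 u = 1 := by
  apply Subtype.ext
  apply LinearEquiv.ext
  intro v
  change v + (0 * cross u v) • u = v
  simp

theorem shear_mul_shear (s s' : ℝ) (u : ℝ × ℝ) : shear s u * shear s' u = shear (s + s') u := by
  apply Subtype.ext
  apply LinearEquiv.ext
  intro v
  change shear s u • shear s' u • v = shear (s + s') u • v
  simp only [shear_smul]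
  ext <;> simp [cross] <;> ring

/-- Symplectic maps carry shears to shears: this transports a break along an orbit. -/
theorem shear_conj (B : Sp) (s : ℝ) (u : ℝ × ℝ) : shear s (B • u) * B = B * shear s u := by
  apply Subtype.ext
  apply LinearEquiv.ext
  intro v
  change shear s (B • u) • B • v = B • shear s u • v
  rw [shear_smul, shear_smul, Sp.cross_smul_smul B, smul_add, Sp.smul_real_smul B]

/-- The direction enters a shear quadratically. This is the source of the squared lengths in the
compatibility condition for breaks. -/
theorem shear_real_smul (s r : ℝ) (u : ℝ × ℝ) : shear s (r • u) = shear (s * r ^ 2) u := by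
  apply Subtype.ext
  apply LinearEquiv.ext
  intro v
  change shear s (r • u) • v = shear (s * r ^ 2) u • v
  simp only [shear_smul]
  ext <;> simp [cross] <;> ring

/-! ### Angles -/

/-- The unit vector at angle `t` (in turns). -/
noncomputable def unitVec (t : ℝ) : ℝ × ℝ := (turn t : ℝ × ℝ)

theorem unitVec_eq (t : ℝ) :
    unitVec t = (Real.cos (2 * Real.pi * t), Real.sin (2 * Real.pi * t)) := rfl

theorem continuous_unitVec : Continuous unitVec := by
  simp only [funext unitVec_eq]
  fun_prop

theorem unitVec_ne_zero (t : ℝ) : unitVec t ≠ 0 := (turn t).ne_zero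

theorem len_unitVec (t : ℝ) : len (unitVec t) = 1 := by
  rw [len, show (unitVec t).1 ^ 2 + (unitVec t).2 ^ 2 = 1 from (turn t).2, Real.sqrt_one]

theorem len_smul {r : ℝ} (hr : 0 ≤ r) (v : ℝ × ℝ) : len (r • v) = r * len v := by
  rw [len, len, ← Real.sqrt_sq hr, ← Real.sqrt_mul (sq_nonneg r), Real.sqrt_sq hr]
  congr 1
  simp only [Prod.smul_fst, Prod.smul_snd, smul_eq_mul]
  ring

theorem continuous_len : Continuous len := by
  unfold len
  fun_prop

theorem len_sq (v : ℝ × ℝ) : len v ^ 2 = v.1 ^ 2 + v.2 ^ 2 :=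
  Real.sq_sqrt (by positivity)

theorem cross_unitVec (t t' : ℝ) :
    cross (unitVec t) (unitVec t') = Real.sin (2 * Real.pi * (t' - t)) := by
  rw [mul_sub, Real.sin_sub, cross, unitVec_eq, unitVec_eq]
  ring

theorem turn_eq_turn_iff {t t' : ℝ} : turn t = turn t' ↔ ∃ k : ℤ, t' = t + k := by
  have h2 : (2 * Real.pi) ≠ 0 := by positivity
  constructor
  · intro h
    have h1 := congrArg (fun u : UnitCircle => (u : ℝ × ℝ)) h
    simp only [turn, Prod.mk.injEq] at h1
    have h3 : (((2 * Real.pi * t' : ℝ)) : Real.Angle) = ((2 * Real.pi * t : ℝ)) :=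
      Real.Angle.cos_sin_inj h1.1.symm h1.2.symm
    obtain ⟨k, hk⟩ := Real.Angle.angle_eq_iff_two_pi_dvd_sub.1 h3
    refine ⟨k, ?_⟩
    have : 2 * Real.pi * (t' - t - k) = 0 := by linear_combination hk
    have := (mul_eq_zero.1 this).resolve_left h2
    linarith
  · rintro ⟨k, rfl⟩
    apply Subtype.ext
    have : 2 * Real.pi * (t + k) = 2 * Real.pi * t + k * (2 * Real.pi) := by ring
    simp only [turn, this, Real.cos_add_int_mul_two_pi, Real.sin_add_int_mul_two_pi]

theorem turn_add_int (t : ℝ) (k : ℤ) : turn (t + k) = turn t :=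
  (turn_eq_turn_iff.2 ⟨k, rfl⟩).symm

theorem unitVec_add_int (t : ℝ) (k : ℤ) : unitVec (t + k) = unitVec t :=
  congrArg Subtype.val (turn_add_int t k)

theorem unitVec_add_one (t : ℝ) : unitVec (t + 1) = unitVec t := by
  simpa using unitVec_add_int t 1

theorem smul_unitVec_inj {r r' t t' : ℝ} (hr : 0 < r) (hr' : 0 ≤ r')
    (h : r • unitVec t = r' • unitVec t') : r = r' ∧ turn t = turn t' := by
  have h1 := congrArg len h
  rw [len_smul hr.le, len_smul hr', len_unitVec, len_unitVec, mul_one, mul_one] at h1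
  subst h1
  exact ⟨rfl, Subtype.ext (smul_right_injective _ hr.ne' h)⟩

/-- The angle of `v` relative to `t₀`, in turns. -/
noncomputable def angleFrom (t₀ : ℝ) (v : ℝ × ℝ) : ℝ :=
  t₀ + Complex.arg ((⟨v.1, v.2⟩ : ℂ) * ⟨(unitVec t₀).1, -(unitVec t₀).2⟩) / (2 * Real.pi)

theorem len_smul_unitVec_angleFrom (t₀ : ℝ) (v : ℝ × ℝ) :
    len v • unitVec (angleFrom t₀ v) = v := by
  set z : ℂ := (⟨v.1, v.2⟩ : ℂ) * ⟨(unitVec t₀).1, -(unitVec t₀).2⟩ with hz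
  have hu : (unitVec t₀).1 ^ 2 + (unitVec t₀).2 ^ 2 = 1 := (turn t₀).2
  have hn : ‖z‖ = len v := by
    rw [← Real.sqrt_sq (norm_nonneg z), ← Complex.normSq_eq_norm_sq, Complex.normSq_apply, len]
    congr 1
    simp only [hz, Complex.mul_re, Complex.mul_im]
    linear_combination (v.1 ^ 2 + v.2 ^ 2) * hu
  have hre := Complex.norm_mul_cos_arg z
  have him := Complex.norm_mul_sin_arg z
  have ha : 2 * Real.pi * angleFrom t₀ v = 2 * Real.pi * t₀ + z.arg := by
    rw [angleFrom, ← hz]; field_simp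
  rw [hn] at hre him
  rw [unitVec_eq, ha, Real.cos_add, Real.sin_add]
  have hr2 : z.re = v.1 * (unitVec t₀).1 + v.2 * (unitVec t₀).2 := by
    simp [hz, Complex.mul_re]
  have hi2 : z.im = v.2 * (unitVec t₀).1 - v.1 * (unitVec t₀).2 := by
    simp [hz, Complex.mul_im]; ring
  rw [hr2] at hre
  rw [hi2] at him
  rw [unitVec_eq] at hre him hu
  simp only at hre him hu
  ext
  · simp only [Prod.smul_fst, smul_eq_mul]
    linear_combination Real.cos (2 * Real.pi * t₀) * hre - Real.sin (2 * Real.pi * t₀) * him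
      + v.1 * hu
  · simp only [Prod.smul_snd, smul_eq_mul]
    linear_combination Real.sin (2 * Real.pi * t₀) * hre + Real.cos (2 * Real.pi * t₀) * him
      + v.2 * hu

/-- The branch of the angle is centred at `t₀`, so its cut lies on the opposite ray. -/
theorem continuousAt_angleFrom (t₀ : ℝ) {r : ℝ} (hr : 0 < r) :
    ContinuousAt (angleFrom t₀) (r • unitVec t₀) := by
  unfold angleFrom
  refine continuousAt_const.add (ContinuousAt.div_const ?_ _)
  have hu : (unitVec t₀).1 ^ 2 + (unitVec t₀).2 ^ 2 = 1 := (turn t₀).2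
  have hz : (⟨(r • unitVec t₀).1, (r • unitVec t₀).2⟩ : ℂ) *
      ⟨(unitVec t₀).1, -(unitVec t₀).2⟩ = (r : ℂ) := by
    apply Complex.ext
    · simp [Complex.mul_re]; linear_combination r * hu
    · simp [Complex.mul_im]; ring
  have hc : Continuous fun v : ℝ × ℝ => (⟨v.1, v.2⟩ : ℂ) * ⟨(unitVec t₀).1, -(unitVec t₀).2⟩ :=
    (Complex.equivRealProdCLM.symm.continuous).mul continuous_const
  refine ContinuousAt.comp (g := Complex.arg) (f := fun v : ℝ × ℝ => (⟨v.1, v.2⟩ : ℂ) *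
    ⟨(unitVec t₀).1, -(unitVec t₀).2⟩) ?_ hc.continuousAt
  apply Complex.continuousAt_arg
  rw [hz]
  exact Complex.ofReal_mem_slitPlane.2 hr

theorem angleFrom_smul_unitVec (t₀ : ℝ) {r : ℝ} (hr : 0 < r) :
    angleFrom t₀ (r • unitVec t₀) = t₀ := by
  have hu : (unitVec t₀).1 ^ 2 + (unitVec t₀).2 ^ 2 = 1 := (turn t₀).2
  have hz : (⟨(r • unitVec t₀).1, (r • unitVec t₀).2⟩ : ℂ) *
      ⟨(unitVec t₀).1, -(unitVec t₀).2⟩ = (r : ℂ) := by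
    apply Complex.ext
    · simp [Complex.mul_re]; linear_combination r * hu
    · simp [Complex.mul_im]; ring
  rw [angleFrom, hz, Complex.arg_ofReal_of_nonneg hr.le, zero_div, add_zero]

theorem exists_turn (u : UnitCircle) : ∃ t, turn t = u := by
  refine ⟨angleFrom 0 u, Subtype.ext ?_⟩
  have h := len_smul_unitVec_angleFrom 0 (u : ℝ × ℝ)
  rwa [len, u.2, Real.sqrt_one, one_smul] at h

/-! ### Developing maps -/

/-- `c` is a developing map, with holonomy `M`, of the cone structure on the punctured plane which
is obtained from the linear structure by inserting a shear of size `σ t` across the ray at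
angle `t`. -/
structure IsDeveloping (σ : ℝ → ℝ) (c : ℝ → ℝ × ℝ) (M : Sp) : Prop where
  map_add_one : ∀ t, c (t + 1) = M • c t
  local_form : ∀ t, ∃ B : Sp, (∀ᶠ x in 𝓝[≤] t, c x = B • unitVec x) ∧
    ∀ᶠ x in 𝓝[≥] t, c x = B • shear (σ t) (unitVec t) • unitVec x

theorem eventually_nhds_of_le_of_ge {t : ℝ} {p : ℝ → Prop} (hl : ∀ᶠ x in 𝓝[≤] t, p x)
    (hr : ∀ᶠ x in 𝓝[≥] t, p x) : ∀ᶠ x in 𝓝 t, p x := by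
  rw [← nhdsLE_sup_nhdsGE]
  exact eventually_sup.2 ⟨hl, hr⟩

theorem isDeveloping_unitVec : IsDeveloping (fun _ => 0) unitVec 1 where
  map_add_one t := by rw [unitVec_add_one, one_smul]
  local_form t := ⟨1, by simp, by simp [shear_zero]⟩

namespace IsDeveloping

variable {σ : ℝ → ℝ} {c : ℝ → ℝ × ℝ} {M : Sp}

theorem map_add_int (hc : IsDeveloping σ c M) (t : ℝ) (k : ℤ) : c (t + k) = M ^ k • c t := by
  induction k using Int.induction_on with
  | zero => simp
  | succ n ih =>
    rw [add_comm ((n : ℤ)) 1, zpow_one_add, mul_smul, ← ih, ← hc.map_add_one]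
    congr 1
    push_cast
    ring
  | pred n ih =>
    have h := hc.map_add_one (t + ((-(n : ℤ) - 1 : ℤ) : ℝ))
    have h2 : t + ((-(n : ℤ) - 1 : ℤ) : ℝ) + 1 = t + ((-(n : ℤ) : ℤ) : ℝ) := by push_cast; ring
    rw [h2, ih] at h
    rw [zpow_sub_one, ← zpow_neg_one, (Commute.refl M).zpow_zpow (-n) (-1), mul_smul, h,
      zpow_neg_one, inv_smul_smul]

theorem continuous (hc : IsDeveloping σ c M) : Continuous c := by
  rw [continuous_iff_continuousAt]
  intro t
  obtain ⟨B, hl, hr⟩ := hc.local_form t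
  rw [continuousAt_iff_continuous_left_right]
  constructor
  · refine ContinuousWithinAt.congr_of_eventuallyEq ?_ hl (hl.self_of_nhdsWithin (by simp))
    exact ((Sp.continuous_smul B).comp continuous_unitVec).continuousWithinAt
  · refine ContinuousWithinAt.congr_of_eventuallyEq ?_ hr (hr.self_of_nhdsWithin (by simp))
    exact ((Sp.continuous_smul B).comp
      ((Sp.continuous_smul _).comp continuous_unitVec)).continuousWithinAt

/-- Nearby values of a developing map already span the plane, so a local identity determines the
symplectic map. -/
theorem eq_of_eventually_smul_eq (hc : IsDeveloping σ c M) {A B : Sp} {t : ℝ}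
    (h : ∀ᶠ x in 𝓝 t, A • c x = B • c x) : A = B := by
  obtain ⟨C, hl, -⟩ := hc.local_form t
  have h1 : ∀ᶠ x in 𝓝[<] t, A • c x = B • c x ∧ c x = C • unitVec x :=
    (h.filter_mono nhdsWithin_le_nhds).and
      (hl.filter_mono (nhdsWithin_mono _ Set.Iio_subset_Iic_self))
  -- Less than half a turn apart, the two directions are linearly independent.
  have h2 : ∀ᶠ x in 𝓝[<] t, x ∈ Set.Ioo (t - 1 / 2) t := Ioo_mem_nhdsLT (by linarith)
  obtain ⟨x, ⟨hx, hx'⟩, hx1, hx2⟩ := (h1.and h2).exists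
  refine Sp.ext_of_cross_ne_zero (u := c x) (v := c t) ?_ hx h.self_of_nhds
  rw [hx', hl.self_of_nhdsWithin (by simp), Sp.cross_smul_smul C, cross_unitVec]
  have hpi := Real.pi_pos
  exact (Real.sin_pos_of_pos_of_lt_pi (by nlinarith) (by nlinarith)).ne'

/-- A map that locally differs from a developing map by a symplectic map does so globally. -/
theorem exists_forall_eq_smul (hc : IsDeveloping σ c M) {J : Set ℝ} (hJ : IsPreconnected J)
    (hJo : IsOpen J) {f : ℝ → ℝ × ℝ}
    (h : ∀ t ∈ J, ∃ A : Sp, ∀ᶠ x in 𝓝 t, f x = A • c x) :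
    ∃ A : Sp, ∀ t ∈ J, f t = A • c t := by
  rcases J.eq_empty_or_nonempty with rfl | ⟨t₀, ht₀⟩
  · exact ⟨1, by simp⟩
  choose! A hA using h
  -- The local symplectic factor is locally constant, hence constant on the connected set `J`.
  have hloc : ∀ t ∈ J, ∀ᶠ x in 𝓝[J] t, A t = A x := by
    intro t ht
    filter_upwards [nhdsWithin_le_nhds (hA t ht).eventually_nhds, self_mem_nhdsWithin] with x hx hxJ
    refine hc.eq_of_eventually_smul_eq (t := x) ?_
    filter_upwards [hx, hA x hxJ] with y hy hy'
    rw [← hy, hy']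
  refine ⟨A t₀, fun t ht => ?_⟩
  have : A t₀ = A t := by
    refine hJ.induction₂ (fun x y => A x = A y) hloc ?_ ?_ ht₀ ht
    · intro x y z _ _ _ h1 h2
      exact h1.trans h2
    · intro x y _ _ h1
      exact h1.symm
  rw [this]
  exact (hA t ht).self_of_nhds

/-- A developing map is linear on every sector without break in its interior. -/
theorem exists_eqOn_Icc (hc : IsDeveloping σ c M) {x y : ℝ} (hxy : x < y)
    (hσ : ∀ t ∈ Set.Ioo x y, σ t = 0) : ∃ B : Sp, ∀ t ∈ Set.Icc x y, c t = B • unitVec t := by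
  obtain ⟨B, hB⟩ := isDeveloping_unitVec.exists_forall_eq_smul (J := Set.Ioo x y)
    isPreconnected_Ioo isOpen_Ioo (f := c) (by
      intro t ht
      obtain ⟨B, hl, hr⟩ := hc.local_form t
      refine ⟨B, eventually_nhds_of_le_of_ge hl ?_⟩
      simpa only [hσ t ht, shear_zero, one_smul] using hr)
  refine ⟨B, fun t ht => ?_⟩
  have hcl : Set.EqOn c (fun t => B • unitVec t) (closure (Set.Ioo x y)) :=
    Set.EqOn.closure hB hc.continuous ((Sp.continuous_smul B).comp continuous_unitVec)
  rw [closure_Ioo hxy.ne] at hcl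
  exact hcl ht

/-- Inserting one more break into a cone structure. -/
theorem exists_insert (hc : IsDeveloping σ c M) (t₀ s : ℝ) [DecidableEq UnitCircle] :
    ∃ c' M', IsDeveloping (fun t => σ t + if turn t = turn t₀ then s else 0) c' M' := by
  set Sh : Sp := shear s (c t₀) with hSh
  set M' : Sp := M * Sh with hM'
  have hback : ∀ (t : ℝ) (k : ℤ), c (t - k) = M ^ (-k) • c t := by
    intro t k
    rw [← hc.map_add_int]
    congr 1
    push_cast
    ring
  -- The curve is kept on the fundamental interval `[t₀, t₀ + 1)` and continued with the new
  -- holonomy, which contains the extra shear.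
  refine ⟨fun t => M' ^ ⌊t - t₀⌋ • c (t - ⌊t - t₀⌋), M', ⟨fun t => ?_, fun t => ?_⟩⟩
  · have : ⌊t + 1 - t₀⌋ = 1 + ⌊t - t₀⌋ := by
      rw [add_sub_right_comm, Int.floor_add_one, add_comm]
    simp only [this, zpow_one_add, mul_smul]
    congr 3
    push_cast
    ring
  · obtain ⟨B, hl, hr⟩ := hc.local_form t
    set k := ⌊t - t₀⌋ with hk
    have hk1 : (k : ℝ) ≤ t - t₀ := Int.floor_le _
    have hk2 : t - t₀ < k + 1 := Int.lt_floor_add_one _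
    have hright : ∀ᶠ x in 𝓝[≥] t, ⌊x - t₀⌋ = k := by
      filter_upwards [Ico_mem_nhdsGE (show t < t₀ + k + 1 by linarith)] with x hx
      rw [Int.floor_eq_iff]
      exact ⟨by linarith [hx.1], by linarith [hx.2]⟩
    have hr' : ∀ᶠ x in 𝓝[≥] t, M' ^ ⌊x - t₀⌋ • c (x - ⌊x - t₀⌋) =
        (M' ^ k * M ^ (-k) * B * shear (σ t) (unitVec t)) • unitVec x := by
      filter_upwards [hright, hr] with x hx hx'
      rw [hx, hback, hx', mul_smul, mul_smul, mul_smul]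
    by_cases hbreak : t = t₀ + k
    · have hturn : turn t = turn t₀ := by rw [hbreak, turn_add_int]
      have hct₀ : M ^ (-k) • B • unitVec t = c t₀ := by
        rw [← hl.self_of_nhdsWithin (by simp), ← hback, hbreak, add_sub_cancel_right]
      have hcomm : Sh * (M ^ (-k) * B) = (M ^ (-k) * B) * shear s (unitVec t) := by
        rw [hSh, ← hct₀, ← mul_smul, shear_conj]
      have hpow : M' ^ k = M' ^ (k - 1) * M * Sh := by
        rw [mul_assoc, ← hM', ← zpow_add_one, sub_add_cancel]
      refine ⟨M' ^ (k - 1) * M * (M ^ (-k) * B), ?_, ?_⟩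
      · filter_upwards [hl, Ioc_mem_nhdsLE (show t₀ + k - 1 < t by linarith)] with x hx hx'
        -- At the break itself the floor has already jumped; the formula from the left persists
        -- because the shear fixes `c t₀`.
        rcases hx'.2.eq_or_lt with rfl | hlt
        · rw [← hk, hback, hpow, mul_smul _ Sh, mul_smul _ (M ^ (-k) * B)]
          congr 1
          rw [mul_smul (M ^ (-k)), hx]
          rw [hct₀, hSh, shear_smul_self]
        · have : ⌊x - t₀⌋ = k - 1 := by
            rw [Int.floor_eq_iff]
            push_cast
            exact ⟨by linarith [hx'.1], by linarith⟩
          rw [this, hback, hx, ← mul_smul, ← mul_smul]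
          congr 1
          group
      · filter_upwards [hr'] with x hx
        rw [hx, if_pos hturn, ← mul_smul]
        congr 1
        rw [add_comm (σ t), ← shear_mul_shear, hpow]
        simp only [mul_assoc] at hcomm ⊢
        rw [← mul_assoc (M ^ (-k)) B (shear s _ * _), ← mul_assoc (M ^ (-k) * B) (shear s _),
          mul_assoc (M ^ (-k)) B (shear s _), ← hcomm]
        simp only [mul_assoc]
    · have hlt : t₀ + k < t := lt_of_le_of_ne (by linarith) (Ne.symm hbreak)
      have hturn : turn t ≠ turn t₀ := by
        intro h
        obtain ⟨j, hj⟩ := turn_eq_turn_iff.1 h.symm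
        have : k = j := by
          rw [hk, hj, add_sub_cancel_left, Int.floor_intCast]
        exact hbreak (this ▸ hj)
      refine ⟨M' ^ k * M ^ (-k) * B, ?_, ?_⟩
      · filter_upwards [hl, Ioc_mem_nhdsLE hlt] with x hx hx'
        have : ⌊x - t₀⌋ = k := by
          rw [Int.floor_eq_iff]
          exact ⟨by linarith [hx'.1], by linarith [hx'.2]⟩
        rw [this, hback, hx, mul_smul, mul_smul]
      · filter_upwards [hr'] with x hx
        rw [hx, if_neg hturn, add_zero, mul_smul]

end IsDeveloping

/-- Every finite set of breaks defines a cone structure. -/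
theorem exists_isDeveloping {ι : Type*} (I : Finset ι) (d : ι → UnitCircle) (s : ι → ℝ)
    [DecidableEq UnitCircle] :
    ∃ c M, IsDeveloping (fun t => ∑ i ∈ I, if turn t = d i then s i else 0) c M := by
  classical
  induction I using Finset.induction_on with
  | empty => exact ⟨_, _, by simpa using isDeveloping_unitVec⟩
  | insert j I hj ih =>
    obtain ⟨c, M, hc⟩ := ih
    obtain ⟨t₀, ht₀⟩ := exists_turn (d j)
    obtain ⟨c', M', h⟩ := hc.exists_insert t₀ (s j)
    refine ⟨c', M', ?_⟩
    rw [ht₀] at h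
    simpa only [Finset.sum_insert hj, add_comm] using h

/-! ### The piecewise linear map near a ray -/

/-- The linear map `(x, y) ↦ (a x - y, x)`. -/
def companion (a : ℝ) : Sp :=
  ⟨{ toFun := fun v => (a * v.1 - v.2, v.1)
     invFun := fun v => (v.2, a * v.2 - v.1)
     map_add' := fun v w => by ext <;> simp; ring
     map_smul' := fun r v => by ext <;> simp; ring
     left_inv := fun v => by ext <;> simp
     right_inv := fun v => by ext <;> simp },
   fun v w => by simp [cross]; ring⟩

theorem companion_smul (a : ℝ) (v : ℝ × ℝ) : companion a • v = (a * v.1 - v.2, v.1) := rfl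

/-- The size of the break of `T a b` at angle `t`. -/
noncomputable def breakSize (a b t : ℝ) : ℝ :=
  if (unitVec t).1 = 0 then (b - a) * (unitVec t).2 else 0

theorem T_eq_of_nonneg (a b : ℝ) {v : ℝ × ℝ} (hv : 0 ≤ v.1) : T a b v = companion a • v := by
  rw [companion_smul]; simp [T, F, hv]

theorem T_eq_of_nonpos (a b : ℝ) {v : ℝ × ℝ} (hv : v.1 ≤ 0) : T a b v = companion b • v := by
  rw [companion_smul]
  rcases hv.eq_or_lt with h | h
  · simp [T, h]
  · simp [T, F, h.not_ge]

theorem eventually_cross_nonpos (t : ℝ) :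
    ∀ᶠ x in 𝓝[≤] t, cross (unitVec t) (unitVec x) ≤ 0 := by
  have hpi := Real.pi_pos
  filter_upwards [Ioc_mem_nhdsLE (show t - 1 / 2 < t by linarith)] with x hx
  rw [cross_unitVec]
  exact Real.sin_nonpos_of_nonpos_of_neg_pi_le (by nlinarith [hx.1, hx.2])
    (by nlinarith [hx.1, hx.2])

theorem eventually_cross_nonneg (t : ℝ) :
    ∀ᶠ x in 𝓝[≥] t, 0 ≤ cross (unitVec t) (unitVec x) := by
  have hpi := Real.pi_pos
  filter_upwards [Ico_mem_nhdsGE (show t < t + 1 / 2 by linarith)] with x hx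
  rw [cross_unitVec]
  exact Real.sin_nonneg_of_nonneg_of_le_pi (by nlinarith [hx.1, hx.2])
    (by nlinarith [hx.1, hx.2])

/-- Crossing north counterclockwise passes from `companion a` to `companion b`, crossing south the
reverse; hence the factor `(unitVec t).2` in `breakSize`. The two linear maps agree on the vertical
axis, so they differ by a shear along it. -/
theorem T_local_form (a b t : ℝ) : ∃ A : Sp,
    (∀ᶠ x in 𝓝[≤] t, T a b (unitVec x) = A • unitVec x) ∧
    ∀ᶠ x in 𝓝[≥] t, T a b (unitVec x) =
      A • shear (breakSize a b t) (unitVec t) • unitVec x := by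
  have hcont : ContinuousAt (fun x => (unitVec x).1) t :=
    (continuous_fst.comp continuous_unitVec).continuousAt
  have hnorm : (unitVec t).1 ^ 2 + (unitVec t).2 ^ 2 = 1 := (turn t).2
  rcases lt_trichotomy (unitVec t).1 0 with h | h | h
  · have h1 : ∀ᶠ x in 𝓝 t, T a b (unitVec x) = companion b • unitVec x :=
      (hcont.eventually_lt continuousAt_const h).mono fun x hx => T_eq_of_nonpos a b hx.le
    rw [breakSize, if_neg h.ne]
    simp only [shear_zero, one_smul]
    exact ⟨companion b, nhdsWithin_le_nhds h1, nhdsWithin_le_nhds h1⟩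
  · have h2 : (unitVec t).2 = 1 ∨ (unitVec t).2 = -1 := by
      rw [h] at hnorm
      exact mul_self_eq_one_iff.1 (by linarith)
    have hcr : ∀ v, cross (unitVec t) v = -((unitVec t).2 * v.1) := by
      intro v; rw [cross, h]; ring
    have hl := eventually_cross_nonpos t
    have hr := eventually_cross_nonneg t
    rw [breakSize, if_pos h]
    rcases h2 with h2 | h2
    · refine ⟨companion a, ?_, ?_⟩
      · filter_upwards [hl] with x hx
        rw [hcr, h2] at hx
        exact T_eq_of_nonneg a b (by linarith)
      · filter_upwards [hr] with x hx
        rw [hcr, h2] at hx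
        rw [T_eq_of_nonpos a b (by linarith), shear_smul, hcr, companion_smul, companion_smul]
        ext <;> simp [h, h2]; ring
    · refine ⟨companion b, ?_, ?_⟩
      · filter_upwards [hl] with x hx
        rw [hcr, h2] at hx
        exact T_eq_of_nonpos a b (by linarith)
      · filter_upwards [hr] with x hx
        rw [hcr, h2] at hx
        rw [T_eq_of_nonneg a b (by linarith), shear_smul, hcr, companion_smul, companion_smul]
        ext <;> simp [h, h2]; ring
  · have h1 : ∀ᶠ x in 𝓝 t, T a b (unitVec x) = companion a • unitVec x :=
      (continuousAt_const.eventually_lt hcont h).mono fun x hx => T_eq_of_nonneg a b hx.le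
    rw [breakSize, if_neg h.ne']
    simp only [shear_zero, one_smul]
    exact ⟨companion a, nhdsWithin_le_nhds h1, nhdsWithin_le_nhds h1⟩

/-- If the breaks `σ` are compatible with those of `T a b`, then `T a b` is symplectic in the
coordinates of a developing map. -/
theorem IsDeveloping.exists_intertwining {σ : ℝ → ℝ} {c : ℝ → ℝ × ℝ} {M : Sp}
    (hc : IsDeveloping σ c M) {a b : ℝ} {Φ : ℝ → ℝ} (hmono : Monotone Φ) (hcont : Continuous Φ)
    (hΦ : ∀ t, T a b (unitVec t) = len (T a b (unitVec t)) • unitVec (Φ t))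
    (hσ : ∀ t, σ t = breakSize a b t + σ (Φ t) / len (T a b (unitVec t)) ^ 2) :
    ∃ A : Sp, ∀ t, len (T a b (unitVec t)) • c (Φ t) = A • c t := by
  obtain ⟨A, hA⟩ := hc.exists_forall_eq_smul (J := Set.univ) isPreconnected_univ isOpen_univ
    (f := fun t => len (T a b (unitVec t)) • c (Φ t)) (by
    intro t _
    obtain ⟨B, hBl, hBr⟩ := hc.local_form t
    obtain ⟨B', hBl', hBr'⟩ := hc.local_form (Φ t)
    obtain ⟨A, hAl, hAr⟩ := T_local_form a b t
    have htl : Tendsto Φ (𝓝[≤] t) (𝓝[≤] (Φ t)) :=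
      tendsto_nhdsWithin_iff.2 ⟨hcont.continuousAt.mono_left nhdsWithin_le_nhds,
        eventually_nhdsWithin_of_forall fun x hx => hmono hx⟩
    have htr : Tendsto Φ (𝓝[≥] t) (𝓝[≥] (Φ t)) :=
      tendsto_nhdsWithin_iff.2 ⟨hcont.continuousAt.mono_left nhdsWithin_le_nhds,
        eventually_nhdsWithin_of_forall fun x hx => hmono hx⟩
    have hl0 : len (T a b (unitVec t)) ≠ 0 := (len_pos (T_ne_zero a b (unitVec_ne_zero t))).ne'
    have hΦt : unitVec (Φ t) = (len (T a b (unitVec t)))⁻¹ • A • unitVec t := by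
      rw [← hAl.self_of_nhdsWithin (by simp), eq_inv_smul_iff₀ hl0, ← hΦ]
    have hsh : shear (σ (Φ t)) (unitVec (Φ t)) * A =
        A * shear (σ (Φ t) / len (T a b (unitVec t)) ^ 2) (unitVec t) := by
      rw [hΦt, shear_real_smul, shear_conj, inv_pow, div_eq_mul_inv]
    -- On the right of `t`, the shear at `Φ t` is pulled back through `A` and added to the break of
    -- `T`; by `hσ` the sum is the shear already present in `c`, so one map serves both sides.
    refine ⟨B' * A * B⁻¹, eventually_nhds_of_le_of_ge ?_ ?_⟩
    · filter_upwards [hBl, hAl, htl.eventually hBl'] with x h1 h2 h3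
      rw [h3, ← Sp.smul_real_smul B', ← hΦ, h1, h2, mul_smul, mul_smul, inv_smul_smul]
    · filter_upwards [hBr, hAr, htr.eventually hBr'] with x h1 h2 h3
      rw [h3, ← Sp.smul_real_smul B', ← Sp.smul_real_smul, ← hΦ, h1, h2, mul_smul, mul_smul,
        inv_smul_smul, ← mul_smul _ A, hsh, mul_smul, ← mul_smul (shear _ _), shear_mul_shear,
        add_comm, ← hσ])
  exact ⟨A, fun t => hA t trivial⟩

/-- Both products describe the action of the plane map followed by one full turn of the angle. -/
theorem IsDeveloping.commute {σ : ℝ → ℝ} {c : ℝ → ℝ × ℝ} {M A : Sp}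
    (hc : IsDeveloping σ c M) {f Φ : ℝ → ℝ} (hf : ∀ t, f (t + 1) = f t)
    (hΦ : ∀ t, Φ (t + 1) = Φ t + 1) (hA : ∀ t, f t • c (Φ t) = A • c t) : Commute A M := by
  refine hc.eq_of_eventually_smul_eq (t := 0) (Eventually.of_forall fun t => ?_)
  rw [mul_smul, mul_smul, ← hc.map_add_one, ← hA, ← hA, hΦ, hc.map_add_one, hf,
    Sp.smul_real_smul]

/-! ### Binary quadratic forms -/

/-- The quadratic form `α x² + β x y + γ y²`. -/
def quadForm (α β γ : ℝ) (v : ℝ × ℝ) : ℝ := α * v.1 ^ 2 + β * v.1 * v.2 + γ * v.2 ^ 2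

theorem continuous_quadForm (α β γ : ℝ) : Continuous (quadForm α β γ) := by
  unfold quadForm
  fun_prop

theorem quadForm_smul (α β γ r : ℝ) (v : ℝ × ℝ) :
    quadForm α β γ (r • v) = r ^ 2 * quadForm α β γ v := by
  simp only [quadForm, Prod.smul_fst, Prod.smul_snd, smul_eq_mul]
  ring

theorem quadForm_neg_coeff (α β γ : ℝ) (v : ℝ × ℝ) :
    quadForm (-α) (-β) (-γ) v = -quadForm α β γ v := by
  simp only [quadForm]
  ring

/-- A change of variables of determinant one keeps the discriminant; this is why all arcs have the
same conic type. -/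
theorem exists_quadForm_smul (α β γ : ℝ) (B : Sp) : ∃ α' β' γ' : ℝ,
    β' ^ 2 - 4 * α' * γ' = β ^ 2 - 4 * α * γ ∧
    ∀ v, quadForm α β γ (B • v) = quadForm α' β' γ' v := by
  obtain ⟨⟨p, q⟩, h1⟩ : ∃ w, B • ((1, 0) : ℝ × ℝ) = w := ⟨_, rfl⟩
  obtain ⟨⟨r, s⟩, h2⟩ : ∃ w, B • ((0, 1) : ℝ × ℝ) = w := ⟨_, rfl⟩
  have hdet : p * s - q * r = 1 := by
    have := Sp.cross_smul_smul B (1, 0) (0, 1)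
    rw [h1, h2] at this
    simpa [cross] using this
  refine ⟨quadForm α β γ (p, q), 2 * α * p * r + β * (p * s + q * r) + 2 * γ * q * s,
    quadForm α β γ (r, s), ?_, fun v => ?_⟩
  · simp only [quadForm]
    linear_combination (β ^ 2 - 4 * α * γ) * (p * s - q * r + 1) * hdet
  · rw [Sp.smul_eq B v, h1, h2]
    simp only [quadForm, Prod.fst_add, Prod.snd_add, Prod.smul_fst, Prod.smul_snd, smul_eq_mul]
    ring

/-- The form `ω(v, Av)` vanishes identically only for scalar `A`, and a scalar of determinant one is
`±1`. -/
theorem exists_invariant_quadForm (A : Sp) :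
    (∃ α β γ : ℝ, ¬ (α = 0 ∧ β = 0 ∧ γ = 0) ∧ ∀ v, cross v (A • v) = quadForm α β γ v) ∨
      ∀ v, quadForm 1 0 1 (A • v) = quadForm 1 0 1 v := by
  obtain ⟨⟨p, q⟩, h1⟩ : ∃ w, A • ((1, 0) : ℝ × ℝ) = w := ⟨_, rfl⟩
  obtain ⟨⟨r, s⟩, h2⟩ : ∃ w, A • ((0, 1) : ℝ × ℝ) = w := ⟨_, rfl⟩
  have hdet : p * s - q * r = 1 := by
    have := Sp.cross_smul_smul A (1, 0) (0, 1)
    rw [h1, h2] at this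
    simpa [cross] using this
  by_cases h : q = 0 ∧ s - p = 0 ∧ -r = 0
  · right
    obtain ⟨rfl, h3, h4⟩ := h
    obtain rfl : s = p := by linarith
    obtain rfl : r = 0 := by linarith
    intro v
    rw [Sp.smul_eq A v, h1, h2]
    simp only [quadForm, Prod.fst_add, Prod.snd_add, Prod.smul_fst, Prod.smul_snd, smul_eq_mul]
    linear_combination (v.1 ^ 2 + v.2 ^ 2) * hdet
  · left
    refine ⟨q, s - p, -r, h, fun v => ?_⟩
    rw [Sp.smul_eq A v, h1, h2]
    simp only [cross, quadForm, Prod.fst_add, Prod.snd_add, Prod.smul_fst, Prod.smul_snd,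
      smul_eq_mul]
    ring

/-- Any symplectic map commuting with `A` preserves `ω(v, Av)`, and likewise with the roles of `A`
and `M` exchanged. -/
theorem exists_common_invariant_quadForm {A M : Sp} (h : Commute A M) :
    ∃ α β γ : ℝ, ¬ (α = 0 ∧ β = 0 ∧ γ = 0) ∧
      (∀ v, quadForm α β γ (A • v) = quadForm α β γ v) ∧
      ∀ v, quadForm α β γ (M • v) = quadForm α β γ v := by
  rcases exists_invariant_quadForm A with ⟨α, β, γ, h0, hq⟩ | hA
  · refine ⟨α, β, γ, h0, fun v => ?_, fun v => ?_⟩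
    · rw [← hq, ← hq, Sp.cross_smul_smul]
    · rw [← hq, ← hq, ← mul_smul, h.eq, mul_smul, Sp.cross_smul_smul]
  rcases exists_invariant_quadForm M with ⟨α, β, γ, h0, hq⟩ | hM
  · refine ⟨α, β, γ, h0, fun v => ?_, fun v => ?_⟩
    · rw [← hq, ← hq, ← mul_smul, ← h.eq, mul_smul, Sp.cross_smul_smul]
    · rw [← hq, ← hq, Sp.cross_smul_smul]
  · exact ⟨1, 0, 1, by simp, hA, hM⟩

/-- On the unit circle the form is real-analytic in the angle, so its zeros are isolated unless it
vanishes identically. -/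
theorem eventually_quadForm_unitVec_ne_zero {α β γ : ℝ} (h : ¬ (α = 0 ∧ β = 0 ∧ γ = 0)) (t : ℝ) :
    ∀ᶠ x in 𝓝[≠] t, quadForm α β γ (unitVec x) ≠ 0 := by
  have han : AnalyticOnNhd ℝ (fun x => quadForm α β γ (unitVec x)) Set.univ := by
    intro x _
    simp only [quadForm, unitVec_eq]
    fun_prop
  rcases (han t trivial).eventually_eq_zero_or_eventually_ne_zero with h0 | h0
  · exfalso
    apply h
    have hz := han.eqOn_zero_of_preconnected_of_eventuallyEq_zero isPreconnected_univ trivial h0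
    -- The angles `0`, `1/4` and `1/8` of a turn recover the three coefficients.
    have e0 := hz (Set.mem_univ 0)
    have e1 := hz (Set.mem_univ (1 / 4))
    have e2 := hz (Set.mem_univ (1 / 8))
    simp only [quadForm, unitVec_eq, Pi.zero_apply] at e0 e1 e2
    rw [show 2 * Real.pi * (1 / 4) = Real.pi / 2 by ring, Real.cos_pi_div_two,
      Real.sin_pi_div_two] at e1
    rw [show 2 * Real.pi * (1 / 8) = Real.pi / 4 by ring, Real.cos_pi_div_four,
      Real.sin_pi_div_four] at e2
    simp only [mul_zero, Real.cos_zero, Real.sin_zero] at e0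
    have hs : (√2 : ℝ) ^ 2 = 2 := Real.sq_sqrt (by norm_num)
    have hα : α = 0 := by linarith
    have hγ : γ = 0 := by linarith
    subst hα hγ
    refine ⟨rfl, ?_, rfl⟩
    linear_combination 2 * e2 - (β / 2) * hs
  · exact h0

theorem IsDeveloping.eventually_quadForm_ne_zero {σ : ℝ → ℝ} {c : ℝ → ℝ × ℝ} {M : Sp}
    (hc : IsDeveloping σ c M) {α β γ : ℝ} (h : ¬ (α = 0 ∧ β = 0 ∧ γ = 0)) (t : ℝ) :
    ∀ᶠ x in 𝓝[≠] t, quadForm α β γ (c x) ≠ 0 := by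
  have key : ∀ B : Sp, ∀ᶠ x in 𝓝[≠] t, quadForm α β γ (B • unitVec x) ≠ 0 := by
    intro B
    obtain ⟨α', β', γ', -, hB⟩ := exists_quadForm_smul α β γ B
    simp only [hB]
    refine eventually_quadForm_unitVec_ne_zero ?_ t
    rintro ⟨rfl, rfl, rfl⟩
    have hz : ∀ v, quadForm α β γ v = 0 := by
      intro v
      have := hB (B⁻¹ • v)
      rw [smul_inv_smul] at this
      rw [this]
      simp [quadForm]
    have e0 := hz (1, 0)
    have e1 := hz (0, 1)
    have e2 := hz (1, 1)
    simp only [quadForm] at e0 e1 e2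
    exact h ⟨by linarith, by linarith, by linarith⟩
  obtain ⟨B, hl, hr⟩ := hc.local_form t
  rw [← nhdsLT_sup_nhdsGT, eventually_sup]
  constructor
  · have h1 := (key B).filter_mono (nhdsWithin_mono t (fun x (hx : x < t) => hx.ne))
    have h2 := hl.filter_mono (nhdsWithin_mono t Set.Iio_subset_Iic_self)
    filter_upwards [h1, h2] with x hx hx'
    rwa [hx']
  · have h1 := (key (B * shear (σ t) (unitVec t))).filter_mono
      (nhdsWithin_mono t (fun x (hx : t < x) => hx.ne'))
    have h2 := hr.filter_mono (nhdsWithin_mono t Set.Ioi_subset_Ici_self)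
    filter_upwards [h1, h2] with x hx hx'
    rwa [hx', ← mul_smul]

/-! ### Lifts of the circle map -/

/-- `Φ` is a lift of `S a b` without periodic points modulo `1`. -/
structure IsAperiodicLift (a b : ℝ) (Φ : CircleDeg1Lift) : Prop where
  cont : Continuous Φ
  lift : ∀ t : ℝ, S a b (turn t) = turn (Φ t)
  iterate_ne : ∀ k : ℕ, 0 < k → ∀ (t : ℝ) (m : ℤ), Φ^[k] t ≠ t + m

theorem isAperiodicLift_of_irrational {a b : ℝ} {Φ : CircleDeg1Lift} (hΦ : Continuous Φ)
    (h : ∀ t : ℝ, S a b (turn t) = turn (Φ t)) (hirr : Irrational Φ.translationNumber) :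
    IsAperiodicLift a b Φ where
  cont := hΦ
  lift := h
  iterate_ne k hk t m hkt := by
    rw [← CircleDeg1Lift.coe_pow] at hkt
    have := CircleDeg1Lift.translationNumber_of_map_pow_eq_add_int _ hkt hk
    exact hirr ⟨(m : ℚ) / (k : ℚ), by rw [this]; push_cast; rfl⟩

namespace IsAperiodicLift

variable {a b : ℝ} {Φ : CircleDeg1Lift}

theorem T_unitVec (h : IsAperiodicLift a b Φ) (t : ℝ) :
    T a b (unitVec t) = len (T a b (unitVec t)) • unitVec (Φ t) := by
  have h1 := congrArg Subtype.val (h.lift t)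
  have hl := (len_pos (T_ne_zero a b (unitVec_ne_zero t))).ne'
  change (len (T a b (unitVec t)))⁻¹ • T a b (unitVec t) = unitVec (Φ t) at h1
  rw [← h1, smul_inv_smul₀ hl]

theorem lift_iterate (h : IsAperiodicLift a b Φ) (k : ℕ) (t : ℝ) :
    (S a b ^ k) (turn t) = turn (Φ^[k] t) := by
  induction k with
  | zero => rfl
  | succ k ih => rw [pow_succ', Equiv.Perm.mul_apply, ih, h.lift, Function.iterate_succ_apply']

theorem zpow_apply_ne (h : IsAperiodicLift a b Φ) {k : ℤ} (hk : k ≠ 0) (u : UnitCircle) :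
    (S a b ^ k) u ≠ u := by
  have hnat : ∀ n : ℕ, 0 < n → (S a b ^ n) u ≠ u := by
    intro n hn hu
    obtain ⟨t, rfl⟩ := exists_turn u
    rw [h.lift_iterate] at hu
    obtain ⟨m, hm⟩ := turn_eq_turn_iff.1 hu.symm
    exact h.iterate_ne n hn t m hm
  obtain ⟨n, rfl | rfl⟩ := k.eq_nat_or_neg
  · rw [zpow_natCast]
    exact hnat n (by omega)
  · intro hu
    rw [zpow_neg, zpow_natCast, Equiv.Perm.inv_eq_iff_eq] at hu
    exact hnat n (by omega) hu.symm

theorem zpow_apply_injective (h : IsAperiodicLift a b Φ) (u : UnitCircle) :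
    Function.Injective fun k : ℤ => (S a b ^ k) u := by
  intro j k hjk
  by_contra hne
  refine h.zpow_apply_ne (k := -k + j) (by omega) u ?_
  simp only at hjk
  rw [zpow_add, Equiv.Perm.mul_apply, hjk, ← Equiv.Perm.mul_apply, ← zpow_add, neg_add_cancel,
    zpow_zero, Equiv.Perm.one_apply]

theorem injective (h : IsAperiodicLift a b Φ) : Function.Injective Φ := by
  intro x y hxy
  have h1 : S a b (turn x) = S a b (turn y) := by rw [h.lift, h.lift, hxy]
  obtain ⟨k, rfl⟩ := turn_eq_turn_iff.1 ((S a b).injective h1)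
  rw [Φ.map_add_int] at hxy
  linarith

theorem strictMono (h : IsAperiodicLift a b Φ) : StrictMono Φ :=
  Φ.monotone.strictMono_of_injective h.injective

theorem surjective (h : IsAperiodicLift a b Φ) : Function.Surjective Φ :=
  h.cont.surjective Φ.tendsto_atTop Φ.tendsto_atBot

/-- A discrete invariant set of angles is empty. -/
theorem notMem_of_isolated (h : IsAperiodicLift a b Φ) {Z : Set ℝ}
    (hiso : ∀ t, ∀ᶠ x in 𝓝[≠] t, x ∉ Z) (hper : ∀ t ∈ Z, ∀ m : ℤ, t + m ∈ Z)
    (hinv : ∀ t ∈ Z, Φ t ∈ Z) (t : ℝ) : t ∉ Z := by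
  intro ht
  have hit : ∀ k : ℕ, Φ^[k] t ∈ Z := by
    intro k
    induction k with
    | zero => exact ht
    | succ k ih => rw [Function.iterate_succ_apply']; exact hinv _ ih
  have hmem : ∀ k : ℕ, Int.fract (Φ^[k] t) ∈ Z ∩ Set.Icc 0 1 := by
    intro k
    refine ⟨?_, Int.fract_nonneg _, (Int.fract_lt_one _).le⟩
    have := hper _ (hit k) (-⌊Φ^[k] t⌋)
    rwa [Int.cast_neg, ← sub_eq_add_neg] at this
  -- Without periodic points the orbit has infinitely many classes modulo one, which accumulate in
  -- `[0, 1]`.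
  have hinj : Function.Injective fun k : ℕ => Int.fract (Φ^[k] t) := by
    intro j k hjk
    obtain ⟨m, hm⟩ := Int.fract_eq_fract.1 hjk
    have : turn (Φ^[j] t) = turn (Φ^[k] t) :=
      (turn_eq_turn_iff.2 ⟨m, by linarith⟩ : turn (Φ^[k] t) = turn (Φ^[j] t)).symm
    rw [← h.lift_iterate, ← h.lift_iterate, ← zpow_natCast, ← zpow_natCast] at this
    exact_mod_cast h.zpow_apply_injective (turn t) this
  have hinf : (Z ∩ Set.Icc 0 1).Infinite := Set.infinite_of_injective_forall_mem hinj hmem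
  obtain ⟨x, -, hx⟩ := hinf.exists_accPt_of_subset_isCompact isCompact_Icc Set.inter_subset_right
  rw [accPt_iff_frequently_nhdsNE] at hx
  exact hx ((hiso x).mono fun y hy hy' => hy hy'.1)

/-- Recurrent circle maps without periodic points are minimal. -/
theorem dense_of_recurrent (h : IsAperiodicLift a b Φ)
    (hrec : ∀ u w : ℝ, u < w → ∃ x ∈ Set.Ioo u w, ∃ k : ℕ, 0 < k ∧ ∃ m : ℤ,
      Φ^[k] x + m ∈ Set.Ioo u w) (t₀ : ℝ) :
    Dense {x : ℝ | ∃ k : ℤ, (S a b ^ k) (turn t₀) = turn x} := by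
  set O := {x : ℝ | ∃ k : ℤ, (S a b ^ k) (turn t₀) = turn x} with hO
  by_contra hd
  obtain ⟨x₀, hx₀⟩ : ∃ x₀, x₀ ∉ closure O := by
    by_contra hall
    push Not at hall
    exact hd hall
  have hmem : ∀ m : ℤ, t₀ + m ∈ closure O := fun m =>
    subset_closure ⟨0, by rw [turn_add_int]; rfl⟩
  have hle : (closure O ∩ Set.Iic x₀).Nonempty := by
    refine ⟨_, hmem (-⌈t₀ - x₀⌉), ?_⟩
    have := Int.le_ceil (t₀ - x₀)
    simp only [Set.mem_Iic]
    push_cast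
    linarith
  have hge : (closure O ∩ Set.Ici x₀).Nonempty := by
    refine ⟨_, hmem ⌈x₀ - t₀⌉, ?_⟩
    have := Int.le_ceil (x₀ - t₀)
    simp only [Set.mem_Ici]
    linarith
  have hbA : BddAbove (closure O ∩ Set.Iic x₀) := ⟨x₀, fun y hy => hy.2⟩
  have hbB : BddBelow (closure O ∩ Set.Ici x₀) := ⟨x₀, fun y hy => hy.2⟩
  have hu := (isClosed_closure.inter isClosed_Iic).csSup_mem hle hbA
  have hw := (isClosed_closure.inter isClosed_Ici).csInf_mem hge hbB
  -- The interval `(u, w)` is the gap of the orbit closure around `x₀`.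
  set u := sSup (closure O ∩ Set.Iic x₀)
  set w := sInf (closure O ∩ Set.Ici x₀)
  have hux : u < x₀ := lt_of_le_of_ne hu.2 fun he => hx₀ (he ▸ hu.1)
  have hxw : x₀ < w := lt_of_le_of_ne hw.2 fun he => hx₀ (he ▸ hw.1)
  have hgap : ∀ y ∈ closure O, y < w → y ≤ u := by
    intro y hy hyw
    by_contra hyu
    rcases le_total y x₀ with hyx | hyx
    · exact hyu (le_csSup hbA ⟨hy, hyx⟩)
    · exact hyw.not_ge (csInf_le hbB ⟨hy, hyx⟩)
  obtain ⟨x, hx, k, hk, m, hm⟩ := hrec u w (hux.trans hxw)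
  have hmono : StrictMono fun y => Φ^[k] y + m := (h.strictMono.iterate k).add_const _
  have hsurj : Function.Surjective fun y => Φ^[k] y + m := by
    intro y
    obtain ⟨z, hz⟩ := h.surjective.iterate k (y - m)
    exact ⟨z, by simp only [hz]; ring⟩
  set Ψ : ℝ ≃o ℝ := hmono.orderIsoOfSurjective _ hsurj
  have hΨ : ∀ y, Ψ y = Φ^[k] y + m := fun y => rfl
  have hpre : Ψ ⁻¹' O = O := by
    ext y
    have hy : turn (Ψ y) = (S a b ^ (k : ℤ)) (turn y) := by
      rw [hΨ, turn_add_int, zpow_natCast, h.lift_iterate]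
    constructor
    · rintro ⟨j, hj⟩
      refine ⟨-k + j, ?_⟩
      rw [zpow_add, Equiv.Perm.mul_apply, hj, hy, ← Equiv.Perm.mul_apply, ← zpow_add,
        neg_add_cancel, zpow_zero, Equiv.Perm.one_apply]
    · rintro ⟨j, hj⟩
      refine ⟨k + j, ?_⟩
      rw [zpow_add, Equiv.Perm.mul_apply, hj, hy]
  have hK : ∀ y, Ψ y ∈ closure O ↔ y ∈ closure O := by
    intro y
    have := Ψ.toHomeomorph.preimage_closure O
    change Ψ ⁻¹' closure O = closure (Ψ ⁻¹' O) at this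
    rw [hpre] at this
    exact Set.ext_iff.1 this y
  rw [← hΨ] at hm
  -- `Ψ` preserves the orbit closure and sends a point of the gap back into the gap. By monotonicity
  -- it must fix the left end `u`, giving a periodic point.
  have h1 : Ψ u ≤ u := by
    refine hgap _ ((hK u).2 hu.1) (lt_of_lt_of_le ?_ hm.2.le)
    exact Ψ.lt_iff_lt.2 hx.1
  have h2 : u ≤ Ψ u := by
    have h3 : Ψ.symm u ∈ closure O := by
      rw [← hK, Ψ.apply_symm_apply]; exact hu.1
    have h4 : Ψ.symm u < x := by
      rw [← Ψ.lt_iff_lt, Ψ.apply_symm_apply]; exact hm.1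
    have h5 := hgap _ h3 (h4.trans hx.2)
    rw [← Ψ.le_iff_le, Ψ.apply_symm_apply] at h5
    exact h5
  have h6 : Ψ u = u := le_antisymm h1 h2
  refine h.iterate_ne k hk u (-m) ?_
  rw [hΨ] at h6
  push_cast
  linarith

end IsAperiodicLift

/-! ### Invariant gauges -/

/-- `N` is a continuous positive function on the plane, homogeneous of degree two and invariant
under `T a b`. -/
structure IsGauge (a b : ℝ) (N : ℝ × ℝ → ℝ) : Prop where
  cont : Continuous N
  smul : ∀ r : ℝ, 0 ≤ r → ∀ v, N (r • v) = r ^ 2 * N v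
  pos : ∀ v, v ≠ 0 → 0 < N v
  map_T : ∀ v, N (T a b v) = N v

theorem len_nonneg (v : ℝ × ℝ) : 0 ≤ len v := Real.sqrt_nonneg _

/-- The homogeneous extension of degree two of a periodic function of the angle. -/
noncomputable def homogExt (g : ℝ → ℝ) (v : ℝ × ℝ) : ℝ := len v ^ 2 * g (angleFrom 0 v)

theorem homogExt_smul_unitVec {g : ℝ → ℝ} (hg : ∀ (t : ℝ) (k : ℤ), g (t + k) = g t) {r : ℝ}
    (hr : 0 ≤ r) (t : ℝ) : homogExt g (r • unitVec t) = r ^ 2 * g t := by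
  rw [homogExt, len_smul hr, len_unitVec, mul_one]
  rcases hr.eq_or_lt with rfl | hr0
  · simp
  have h := len_smul_unitVec_angleFrom 0 (r • unitVec t)
  rw [len_smul hr, len_unitVec, mul_one] at h
  obtain ⟨k, hk⟩ := turn_eq_turn_iff.1 (smul_unitVec_inj hr0 hr h).2
  conv_rhs => rw [hk, hg]

theorem continuous_homogExt {g : ℝ → ℝ} (hg : ∀ (t : ℝ) (k : ℤ), g (t + k) = g t)
    (hc : Continuous g) : Continuous (homogExt g) := by
  rw [continuous_iff_continuousAt]
  intro v
  by_cases hv : v = 0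
  · subst hv
    -- At the origin the angle is meaningless; boundedness of `g` and the factor `len v ^ 2` give
    -- continuity.
    obtain ⟨K, hK⟩ := (isCompact_Icc (a := (0 : ℝ)) (b := 1)).exists_bound_of_continuousOn
      hc.continuousOn
    have hb : ∀ w, ‖homogExt g w‖ ≤ len w ^ 2 * K := by
      intro w
      rw [homogExt, norm_mul, Real.norm_of_nonneg (sq_nonneg _)]
      refine mul_le_mul_of_nonneg_left ?_ (sq_nonneg _)
      have h1 := hg (Int.fract (angleFrom 0 w)) ⌊angleFrom 0 w⌋
      rw [Int.fract_add_floor] at h1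
      rw [h1]
      exact hK _ ⟨Int.fract_nonneg _, (Int.fract_lt_one _).le⟩
    have h0 : homogExt g 0 = 0 := by simp [homogExt, len]
    rw [ContinuousAt, h0]
    refine squeeze_zero_norm hb ?_
    have : Continuous fun w => len w ^ 2 * K := (continuous_len.pow 2).mul_const K
    simpa [len] using this.tendsto 0
  · have hl := len_pos hv
    set t₀ := angleFrom 0 v
    have hv' : len v • unitVec t₀ = v := len_smul_unitVec_angleFrom 0 v
    -- By periodicity the branch of the angle may be recentred at the point considered.
    have heq : homogExt g = fun w => len w ^ 2 * g (angleFrom t₀ w) := by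
      funext w
      conv_lhs => rw [← len_smul_unitVec_angleFrom t₀ w]
      exact homogExt_smul_unitVec hg (Real.sqrt_nonneg _) _
    rw [heq]
    have ha : ContinuousAt (angleFrom t₀) v := hv' ▸ continuousAt_angleFrom t₀ hl
    exact (continuous_len.pow 2).continuousAt.mul (hc.continuousAt.comp ha)

/-- A cone structure with breaks compatible with `T a b` yields an invariant gauge which is a
quadratic form in the developing coordinates. -/
theorem IsDeveloping.exists_isGauge {σ : ℝ → ℝ} {c : ℝ → ℝ × ℝ} {M : Sp}
    (hc : IsDeveloping σ c M) {a b : ℝ} {Φ : CircleDeg1Lift} (hΦ : IsAperiodicLift a b Φ)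
    (hσ : ∀ t, σ t = breakSize a b t + σ (Φ t) / len (T a b (unitVec t)) ^ 2) :
    ∃ (N : ℝ × ℝ → ℝ) (α β γ : ℝ), IsGauge a b N ∧
      ∀ t, N (unitVec t) = quadForm α β γ (c t) := by
  obtain ⟨A, hA⟩ := hc.exists_intertwining Φ.monotone hΦ.cont hΦ.T_unitVec hσ
  have hcomm := hc.commute (f := fun t => len (T a b (unitVec t)))
    (fun t => by rw [unitVec_add_one]) Φ.map_add_one hA
  obtain ⟨α, β, γ, h0, hqA, hqM⟩ := exists_common_invariant_quadForm hcomm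
  have hlpos : ∀ t, 0 < len (T a b (unitVec t)) := fun t =>
    len_pos (T_ne_zero a b (unitVec_ne_zero t))
  have hqM' : ∀ (k : ℤ) v, quadForm α β γ (M ^ k • v) = quadForm α β γ v := by
    intro k
    induction k using Int.induction_on with
    | zero => simp
    | succ n ih => intro v; rw [zpow_add_one, mul_smul, ih, hqM]
    | pred n ih =>
      intro v
      rw [zpow_sub_one, mul_smul, ih, ← hqM, smul_inv_smul]
  have hper : ∀ (t : ℝ) (k : ℤ), quadForm α β γ (c (t + k)) = quadForm α β γ (c t) := by
    intro t k
    rw [hc.map_add_int, hqM']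
  have hΦg : ∀ t, len (T a b (unitVec t)) ^ 2 * quadForm α β γ (c (Φ t)) =
      quadForm α β γ (c t) := by
    intro t
    rw [← quadForm_smul, hA, hqA]
  -- The zero angles form an isolated, periodic and `Φ`-invariant set.
  have hne : ∀ t, quadForm α β γ (c t) ≠ 0 := by
    refine hΦ.notMem_of_isolated (Z := {t | quadForm α β γ (c t) = 0})
      (hc.eventually_quadForm_ne_zero h0) ?_ ?_
    · intro t ht m
      exact (hper t m).trans ht
    · intro t ht
      have h1 := hΦg t
      rw [show quadForm α β γ (c t) = 0 from ht] at h1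
      exact (mul_eq_zero.1 h1).resolve_left (pow_pos (hlpos t) 2).ne'
  have hcont : Continuous fun t => quadForm α β γ (c t) :=
    (continuous_quadForm α β γ).comp hc.continuous
  -- A continuous function without zeros has constant sign; `ε = ±1` records the change of sign of
  -- the form.
  obtain ⟨α', β', γ', hrel, hpos⟩ : ∃ α' β' γ' : ℝ,
      (∃ ε : ℝ, ∀ v, quadForm α' β' γ' v = ε * quadForm α β γ v) ∧
      ∀ t, 0 < quadForm α' β' γ' (c t) := by
    have hsign : (∀ t, 0 < quadForm α β γ (c t)) ∨ ∀ t, quadForm α β γ (c t) < 0 := by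
      by_contra hcon
      push Not at hcon
      obtain ⟨⟨x, hx⟩, ⟨y, hy⟩⟩ := hcon
      obtain ⟨z, hz⟩ := mem_range_of_exists_le_of_exists_ge hcont ⟨x, hx⟩ ⟨y, hy⟩
      exact hne z hz
    rcases hsign with hs | hs
    · exact ⟨α, β, γ, ⟨1, fun v => (one_mul _).symm⟩, hs⟩
    · refine ⟨-α, -β, -γ, ⟨-1, fun v => ?_⟩, fun t => ?_⟩
      · rw [quadForm_neg_coeff]; ring
      · rw [quadForm_neg_coeff]; linarith [hs t]
  obtain ⟨ε, hε⟩ := hrel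
  set g : ℝ → ℝ := fun t => quadForm α' β' γ' (c t) with hg
  have hgper : ∀ (t : ℝ) (k : ℤ), g (t + k) = g t := by
    intro t k
    simp only [hg, hε, hper]
  have hN : ∀ (r : ℝ), 0 ≤ r → ∀ t, homogExt g (r • unitVec t) = r ^ 2 * g t := fun r hr t =>
    homogExt_smul_unitVec hgper hr t
  refine ⟨homogExt g, α', β', γ', ⟨?_, ?_, ?_, ?_⟩, ?_⟩
  · exact continuous_homogExt hgper ((continuous_quadForm _ _ _).comp hc.continuous)
  · intro r hr v
    rw [← len_smul_unitVec_angleFrom 0 v, smul_smul, hN _ (mul_nonneg hr (len_nonneg _)),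
      hN _ (len_nonneg _)]
    ring
  · intro v hv
    exact mul_pos (pow_pos (len_pos hv) 2) (hpos _)
  · intro v
    by_cases hv : v = 0
    · subst hv
      rw [show T a b 0 = 0 by ext <;> simp [T]]
    · have hl := len_pos hv
      rw [← len_smul_unitVec_angleFrom 0 v, T_smul a b hl, hΦ.T_unitVec, smul_smul,
        hN _ (mul_nonneg hl.le (hlpos _).le), hN _ hl.le, mul_pow, mul_assoc]
      congr 1
      simp only [hg, hε]
      rw [← hΦg (angleFrom 0 v)]
      ring
  · intro t
    have := hN 1 zero_le_one t
    rwa [one_smul, one_pow, one_mul] at this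

/-- On each vertical line the map is the reflection `y ↦ F(x) x - y`, followed by the exchange of
coordinates. -/
theorem measurePreserving_T (a b : ℝ) :
    MeasureTheory.MeasurePreserving (T a b) MeasureTheory.volume MeasureTheory.volume := by
  have hF : Measurable fun x : ℝ => F a b x * x := by
    unfold F
    exact (Measurable.ite measurableSet_Ici measurable_const measurable_const).mul measurable_id
  have h1 : MeasureTheory.MeasurePreserving (fun p : ℝ × ℝ => (p.1, F a b p.1 * p.1 - p.2))
      (MeasureTheory.volume.prod MeasureTheory.volume)
      (MeasureTheory.volume.prod MeasureTheory.volume) := by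
    refine (MeasureTheory.MeasurePreserving.id MeasureTheory.volume).skew_product
      (g := fun x y => F a b x * x - y) ?_ (Eventually.of_forall fun x => ?_)
    · exact (hF.comp measurable_fst).sub measurable_snd
    · exact (MeasureTheory.Measure.measurePreserving_sub_left _ _).map_eq
  exact MeasureTheory.Measure.measurePreserving_swap.comp h1

/-! ### Recurrence and level curves of a gauge -/

namespace IsGauge

variable {a b : ℝ} {N : ℝ × ℝ → ℝ}

theorem exists_mul_len_sq_le (h : IsGauge a b N) : ∃ m : ℝ, 0 < m ∧ ∀ v, m * len v ^ 2 ≤ N v := by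
  obtain ⟨t, -, ht⟩ := (isCompact_Icc (a := (0 : ℝ)) (b := 1)).exists_isMinOn
    (Set.nonempty_Icc.2 zero_le_one) (h.cont.comp continuous_unitVec).continuousOn
  refine ⟨N (unitVec t), h.pos _ (unitVec_ne_zero t), fun v => ?_⟩
  have h1 := unitVec_add_int (Int.fract (angleFrom 0 v)) ⌊angleFrom 0 v⌋
  rw [Int.fract_add_floor] at h1
  have h2 : N (unitVec t) ≤ N (unitVec (angleFrom 0 v)) := by
    rw [h1]
    exact ht ⟨Int.fract_nonneg _, (Int.fract_lt_one _).le⟩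
  have h3 : N v = len v ^ 2 * N (unitVec (angleFrom 0 v)) := by
    rw [← h.smul _ (len_nonneg _), len_smul_unitVec_angleFrom]
  rw [h3, mul_comm]
  exact mul_le_mul_of_nonneg_left h2 (sq_nonneg _)

theorem isBounded_lt (h : IsGauge a b N) (C : ℝ) : Bornology.IsBounded {v | N v < C} := by
  obtain ⟨m, hm, hmN⟩ := h.exists_mul_len_sq_le
  refine (Metric.isBounded_closedBall (x := (0 : ℝ × ℝ)) (r := √(C / m))).subset fun v hv => ?_
  have h1 : len v ^ 2 ≤ C / m := by
    rw [le_div_iff₀ hm]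
    linarith [hmN v, show N v < C from hv]
  rw [len_sq] at h1
  rw [mem_closedBall_zero_iff, Prod.norm_def, sup_le_iff, Real.norm_eq_abs, Real.norm_eq_abs]
  exact ⟨Real.abs_le_sqrt (by nlinarith [sq_nonneg v.2]),
    Real.abs_le_sqrt (by nlinarith [sq_nonneg v.1])⟩

/-- A sublevel set of `N` is bounded, hence of finite area, and invariant. Poincaré recurrence,
applied to an open set of vectors with angle in `(u, w)`, gives a return of the plane map, and its
angle is a return of the lift. -/
theorem recurrent (h : IsGauge a b N) {Φ : CircleDeg1Lift} (hΦ : IsAperiodicLift a b Φ)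
    (u w : ℝ) (huw : u < w) : ∃ x ∈ Set.Ioo u w, ∃ k : ℕ, 0 < k ∧ ∃ m : ℤ,
      Φ^[k] x + m ∈ Set.Ioo u w := by
  obtain ⟨x₀, hx₀⟩ := exists_between huw
  have hang : ∀ᶠ v in 𝓝 (unitVec x₀), angleFrom x₀ v ∈ Set.Ioo u w := by
    have h1 := continuousAt_angleFrom x₀ one_pos
    have h2 := angleFrom_smul_unitVec x₀ one_pos
    rw [one_smul] at h1 h2
    exact h1 (by rw [h2]; exact Ioo_mem_nhds hx₀.1 hx₀.2)
  have hnear : ∀ᶠ v in 𝓝 (unitVec x₀), N v < N (unitVec x₀) + 1 ∧ v ≠ 0 ∧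
      angleFrom x₀ v ∈ Set.Ioo u w :=
    (h.cont.continuousAt.eventually_lt continuousAt_const (by linarith)).and
      ((eventually_ne_nhds (unitVec_ne_zero x₀)).and hang)
  obtain ⟨U, hU, hUo, hxU⟩ := eventually_nhds_iff.1 hnear
  set W : Set (ℝ × ℝ) := {v | N v < N (unitVec x₀) + 1} with hW
  have hWm : MeasurableSet W := (isOpen_lt h.cont continuous_const).measurableSet
  set μ := (MeasureTheory.volume : MeasureTheory.Measure (ℝ × ℝ)).restrict W with hμ
  have : MeasureTheory.IsFiniteMeasure μ := by
    refine ⟨?_⟩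
    rw [hμ, MeasureTheory.Measure.restrict_apply_univ]
    exact (h.isBounded_lt _).measure_lt_top
  have hpre : T a b ⁻¹' W = W := by
    ext v
    simp only [hW, Set.mem_preimage, Set.mem_ofPred_eq, h.map_T]
  have hT : MeasureTheory.MeasurePreserving (T a b) μ μ := by
    have := (measurePreserving_T a b).restrict_preimage hWm
    rwa [hpre] at this
  have hpos : μ U ≠ 0 := by
    rw [hμ, MeasureTheory.Measure.restrict_apply hUo.measurableSet,
      Set.inter_eq_self_of_subset_left (show U ⊆ W from fun v hv => (hU v hv).1)]
    exact (hUo.measure_pos _ ⟨_, hxU⟩).ne'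
  obtain ⟨v, hv, k, hk, hkv⟩ :=
    hT.exists_mem_iterate_mem hUo.measurableSet.nullMeasurableSet hpos
  have hrepr : ∀ j : ℕ, ∃ r : ℝ, 0 < r ∧
      (T a b)^[j] v = r • unitVec (Φ^[j] (angleFrom x₀ v)) := by
    intro j
    induction j with
    | zero => exact ⟨len v, len_pos (hU v hv).2.1, (len_smul_unitVec_angleFrom x₀ v).symm⟩
    | succ j ih =>
      obtain ⟨r, hr, hj⟩ := ih
      refine ⟨_, mul_pos hr (len_pos (T_ne_zero a b
        (unitVec_ne_zero (Φ^[j] (angleFrom x₀ v))))), ?_⟩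
      rw [Function.iterate_succ_apply', Function.iterate_succ_apply', hj, T_smul a b hr,
        mul_smul, ← hΦ.T_unitVec]
  obtain ⟨r, hr, hrk⟩ := hrepr k
  refine ⟨angleFrom x₀ v, (hU v hv).2.2, k, Nat.pos_of_ne_zero hk, ?_⟩
  have hlast := len_smul_unitVec_angleFrom x₀ ((T a b)^[k] v)
  have heq : r • unitVec (Φ^[k] (angleFrom x₀ v)) =
      len ((T a b)^[k] v) • unitVec (angleFrom x₀ ((T a b)^[k] v)) := by
    rw [hlast, hrk]
  obtain ⟨m, hm⟩ := turn_eq_turn_iff.1 (smul_unitVec_inj hr (Real.sqrt_nonneg _) heq).2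
  exact ⟨m, hm ▸ (hU _ hkv).2.2⟩

/-- The point of the level set `N = C` at angle `t`. -/
noncomputable def levelCurve (N : ℝ × ℝ → ℝ) (C t : ℝ) : ℝ × ℝ :=
  √(C / N (unitVec t)) • unitVec t

theorem continuous_levelCurve (h : IsGauge a b N) (C : ℝ) : Continuous (levelCurve N C) := by
  unfold levelCurve
  have hN : Continuous fun t => N (unitVec t) := h.cont.comp continuous_unitVec
  exact (Real.continuous_sqrt.comp (continuous_const.div hN
    fun t => (h.pos _ (unitVec_ne_zero t)).ne')).smul continuous_unitVec

theorem levelCurve_mem (h : IsGauge a b N) {C : ℝ} (hC : 0 < C) (t : ℝ) :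
    N (levelCurve N C t) = C := by
  have hp := h.pos _ (unitVec_ne_zero t)
  rw [levelCurve, h.smul _ (Real.sqrt_nonneg _), Real.sq_sqrt (by positivity)]
  field_simp

theorem eq_levelCurve (h : IsGauge a b N) {r t : ℝ} (hr : 0 ≤ r) :
    r • unitVec t = levelCurve N (N (r • unitVec t)) t := by
  have hp := h.pos _ (unitVec_ne_zero t)
  rw [levelCurve, h.smul _ hr, mul_div_cancel_right₀ _ hp.ne', Real.sqrt_sq hr]

theorem levelCurve_eq_iff (h : IsGauge a b N) {C : ℝ} (hC : 0 < C) {t t' : ℝ} :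
    levelCurve N C t = levelCurve N C t' ↔ turn t = turn t' := by
  constructor
  · intro he
    exact (smul_unitVec_inj (Real.sqrt_pos.2 (div_pos hC (h.pos _ (unitVec_ne_zero t))))
      (Real.sqrt_nonneg _) he).2
  · intro he
    have : unitVec t = unitVec t' := congrArg Subtype.val he
    rw [levelCurve, levelCurve, this]

theorem range_levelCurve (h : IsGauge a b N) {C : ℝ} (hC : 0 < C) :
    Set.range (levelCurve N C) = {v | N v = C} := by
  ext v
  constructor
  · rintro ⟨t, rfl⟩
    exact h.levelCurve_mem hC t
  · intro hv
    refine ⟨angleFrom 0 v, ?_⟩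
    have := h.eq_levelCurve (r := len v) (t := angleFrom 0 v) (Real.sqrt_nonneg _)
    rw [len_smul_unitVec_angleFrom, show N v = C from hv] at this
    exact this.symm

theorem apply_zpow (h : IsGauge a b N) (k : ℤ) (v : ℝ × ℝ) : N ((T a b ^ k) v) = N v := by
  induction k using Int.induction_on with
  | zero => rfl
  | succ n ih => rw [add_comm, zpow_one_add, Equiv.Perm.mul_apply, h.map_T, ih]
  | pred n ih =>
    rw [← ih, ← h.map_T, ← Equiv.Perm.mul_apply, ← zpow_one_add]
    congr 3
    ring

end IsGauge

/-! ### Comparison of the iterates of the plane map and the circle map -/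

theorem T_zpow_smul (a b : ℝ) (k : ℤ) {r : ℝ} (hr : 0 < r) (v : ℝ × ℝ) :
    (T a b ^ k) (r • v) = r • (T a b ^ k) v := by
  induction k using Int.induction_on with
  | zero => rfl
  | succ n ih =>
    rw [add_comm, zpow_one_add, Equiv.Perm.mul_apply, ih, T_smul a b hr, Equiv.Perm.mul_apply]
  | pred n ih =>
    rw [sub_eq_add_neg, add_comm, zpow_add, Equiv.Perm.mul_apply, ih, Equiv.Perm.mul_apply,
      zpow_neg_one]
    exact T_symm_smul a b hr _

theorem exists_T_zpow_eq_smul (a b : ℝ) (k : ℤ) (u : UnitCircle) :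
    ∃ r : ℝ, 0 < r ∧ (T a b ^ k) u = r • ((S a b ^ k) u : ℝ × ℝ) := by
  induction k using Int.induction_on with
  | zero => exact ⟨1, one_pos, by simp⟩
  | succ n ih =>
    obtain ⟨r, hr, h⟩ := ih
    set w := (S a b ^ (n : ℤ)) u
    have hl := len_pos (T_ne_zero a b w.ne_zero)
    refine ⟨r * len (T a b w), mul_pos hr hl, ?_⟩
    rw [add_comm, zpow_one_add, zpow_one_add, Equiv.Perm.mul_apply, Equiv.Perm.mul_apply, h,
      T_smul a b hr, mul_smul]
    congr 1
    change _ = len (T a b w) • ((len (T a b w))⁻¹ • T a b w)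
    rw [smul_inv_smul₀ hl.ne']
  | pred n ih =>
    obtain ⟨r, hr, h⟩ := ih
    set w := (S a b ^ (-(n : ℤ))) u
    have hl := len_pos (T_symm_ne_zero a b w.ne_zero)
    refine ⟨r * len ((T a b).symm w), mul_pos hr hl, ?_⟩
    rw [sub_eq_add_neg, add_comm, zpow_add, zpow_add, Equiv.Perm.mul_apply, Equiv.Perm.mul_apply,
      h, zpow_neg_one, zpow_neg_one, mul_smul]
    change (T a b).symm _ = _
    rw [T_symm_smul a b hr]
    congr 1
    change _ = len ((T a b).symm w) • ((len ((T a b).symm w))⁻¹ • (T a b).symm w)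
    rw [smul_inv_smul₀ hl.ne']

/-! ### Level sets of a gauge as orbit closures and invariant circles -/

namespace IsGauge

variable {a b : ℝ} {N : ℝ × ℝ → ℝ}

/-- The orbit closures are the level sets of an invariant gauge. -/
theorem closure_orbit (h : IsGauge a b N) {Φ : CircleDeg1Lift} (hΦ : IsAperiodicLift a b Φ)
    {v : ℝ × ℝ} (hv : v ≠ 0) : closure (orbit (T a b) v) = {w | N w = N v} := by
  have hC := h.pos v hv
  apply Set.Subset.antisymm
  · refine closure_minimal ?_ (isClosed_eq h.cont continuous_const)
    rintro _ ⟨k, rfl⟩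
    exact h.apply_zpow k v
  · rw [← h.range_levelCurve hC]
    have hd := hΦ.dense_of_recurrent (h.recurrent hΦ) (angleFrom 0 v)
    refine ((h.continuous_levelCurve (N v)).range_subset_closure_image_dense hd).trans
      (closure_mono ?_)
    rintro _ ⟨x, ⟨k, hk⟩, rfl⟩
    refine ⟨k, ?_⟩
    obtain ⟨r, hr, hrk⟩ := exists_T_zpow_eq_smul a b k (turn (angleFrom 0 v))
    have hl := len_pos hv
    have hkv : (T a b ^ k) v = (len v * r) • unitVec x := by
      conv_lhs => rw [← len_smul_unitVec_angleFrom 0 v]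
      rw [T_zpow_smul a b k hl, unitVec, hrk, hk, smul_smul]
      rfl
    change (T a b ^ k) v = _
    rw [← h.apply_zpow k v, hkv]
    exact h.eq_levelCurve (mul_pos hl hr).le

/-- The level sets of an invariant gauge are invariant circles. -/
theorem isInvariantCircle (h : IsGauge a b N) {C : ℝ} (hC : 0 < C) :
    IsInvariantCircle (T a b) {v | N v = C} := by
  have h0 : N 0 = 0 := by
    have := h.smul 0 le_rfl 0
    simpa using this
  refine ⟨?_, ⟨?_, ?_⟩, ?_⟩
  -- Radial projection gives a continuous bijection from the compact circle, hence a homeomorphism.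
  · have hz : ∀ z : Circle, ((z : ℂ).re, (z : ℂ).im) ≠ (0 : ℝ × ℝ) := by
      intro z hz
      have h1 := congrArg Prod.fst hz
      have h2 := congrArg Prod.snd hz
      exact z.coe_ne_zero (Complex.ext h1 h2)
    let f : Circle → {v | N v = C} := fun z =>
      ⟨√(C / N ((z : ℂ).re, (z : ℂ).im)) • ((z : ℂ).re, (z : ℂ).im), by
        have hp := h.pos _ (hz z)
        rw [Set.mem_ofPred_eq, h.smul _ (Real.sqrt_nonneg _), Real.sq_sqrt (by positivity)]
        field_simp⟩
    have hcoord : Continuous fun z : Circle => (((z : ℂ).re, (z : ℂ).im) : ℝ × ℝ) :=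
      (Complex.continuous_re.comp continuous_subtype_val).prodMk
        (Complex.continuous_im.comp continuous_subtype_val)
    have hfc : Continuous f :=
      Continuous.subtype_mk ((Real.continuous_sqrt.comp (continuous_const.div
        (h.cont.comp hcoord) fun z => (h.pos _ (hz z)).ne')).smul hcoord) _
    have hunit : ∀ z : Circle, (z : ℂ).re ^ 2 + (z : ℂ).im ^ 2 = 1 := by
      intro z
      have := z.normSq_coe
      rw [Complex.normSq_apply] at this
      linarith
    have hlen : ∀ z : Circle, len ((z : ℂ).re, (z : ℂ).im) = 1 := by
      intro z
      rw [len, hunit z, Real.sqrt_one]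
    have hfb : Function.Bijective f := by
      constructor
      · intro z z' hzz
        have h1 : √(C / N ((z : ℂ).re, (z : ℂ).im)) • (((z : ℂ).re, (z : ℂ).im) : ℝ × ℝ) =
            √(C / N ((z' : ℂ).re, (z' : ℂ).im)) • ((z' : ℂ).re, (z' : ℂ).im) :=
          congrArg Subtype.val hzz
        have h2 := congrArg len h1
        rw [len_smul (Real.sqrt_nonneg _), len_smul (Real.sqrt_nonneg _), hlen, hlen, mul_one,
          mul_one] at h2
        rw [← h2] at h1
        have h3 := smul_right_injective (ℝ × ℝ)
          (Real.sqrt_pos.2 (div_pos hC (h.pos _ (hz z)))).ne' h1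
        exact Circle.ext (Complex.ext (congrArg Prod.fst h3) (congrArg Prod.snd h3))
      · rintro ⟨v, hv⟩
        have hu : (unitVec (angleFrom 0 v)).1 ^ 2 + (unitVec (angleFrom 0 v)).2 ^ 2 = 1 :=
          (turn _).2
        refine ⟨⟨⟨(unitVec (angleFrom 0 v)).1, (unitVec (angleFrom 0 v)).2⟩, ?_⟩, ?_⟩
        · refine mem_sphere_zero_iff_norm.2 ((pow_eq_one_iff_of_nonneg (norm_nonneg _)
            two_ne_zero).1 ?_)
          rw [← Complex.normSq_eq_norm_sq, Complex.normSq_apply]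
          linarith
        · apply Subtype.ext
          have := h.eq_levelCurve (r := len v) (t := angleFrom 0 v) (Real.sqrt_nonneg _)
          rw [len_smul_unitVec_angleFrom, show N v = C from hv] at this
          exact this.symm
    exact ⟨(hfc.homeoOfEquivCompactToT2 (f := Equiv.ofBijective f hfb)).symm⟩
  · intro hmem
    rw [Set.mem_ofPred_eq, h0] at hmem
    exact hC.ne hmem
  · refine (h.isBounded_lt C).subset fun x hx => ?_
    by_contra hxC
    -- On the component of the origin `N` starts at `0` and, by connectedness, cannot pass `C`
    -- without taking that value.
    have hpre := (isPreconnected_connectedComponentIn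
      (x := (0 : ℝ × ℝ)) (F := {v | N v = C}ᶜ)).image N h.cont.continuousOn
    have hmem0 : (0 : ℝ × ℝ) ∈ connectedComponentIn {v | N v = C}ᶜ 0 := by
      by_contra hn
      have : connectedComponentIn {v | N v = C}ᶜ (0 : ℝ × ℝ) = ∅ := by
        rw [connectedComponentIn_eq_empty]
        intro h1
        exact hn (mem_connectedComponentIn h1)
      rw [this] at hx
      exact hx
    obtain ⟨y, hy, hyC⟩ := hpre.ordConnected.out ⟨0, hmem0, h0⟩ ⟨x, hx, rfl⟩
      ⟨hC.le, not_lt.1 hxC⟩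
    exact connectedComponentIn_subset _ _ hy hyC
  · ext v
    constructor
    · rintro ⟨w, hw, rfl⟩
      exact (h.map_T w).trans hw
    · intro hv
      refine ⟨(T a b).symm v, ?_, (T a b).apply_symm_apply v⟩
      rw [Set.mem_ofPred_eq, ← h.map_T, Equiv.apply_symm_apply]
      exact hv

end IsGauge

/-! ### Reversibility -/

/-- `T a b` is conjugate to its inverse by the exchange of the coordinates. -/
theorem T_zpow_swap (a b : ℝ) (k : ℤ) (v : ℝ × ℝ) :
    (T a b ^ (-k)) v.swap = ((T a b ^ k) v).swap := by
  set R : Equiv.Perm (ℝ × ℝ) := Equiv.prodComm ℝ ℝ with hR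
  have h1 : R * T a b * R⁻¹ = (T a b)⁻¹ := by
    rw [mul_inv_eq_iff_eq_mul]
    ext v <;> rfl
  have h2 : T a b ^ (-k) = R * T a b ^ k * R⁻¹ := by
    rw [← conj_zpow, h1, inv_zpow, zpow_neg]
  rw [h2]
  rfl

/-- A return of the circle map from north to south is a return of the plane map. -/
theorem T_zpow_north {a b : ℝ} {n : ℤ} (h : (S a b ^ n) north = south) :
    (T a b ^ n) (0, 1) = ((0, -1) : ℝ × ℝ) := by
  obtain ⟨r, hr, hrn⟩ := exists_T_zpow_eq_smul a b n north
  rw [h] at hrn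
  change (T a b ^ n) (0, 1) = r • ((0, -1) : ℝ × ℝ) at hrn
  have hT1 : T a b (0, -1) = (1, 0) := by ext <;> simp [T]
  have hT2 : T a b (0, 1) = (-1, 0) := by ext <;> simp [T]
  -- The exchange sends `(0, 1)` and `(0, -1)` to `T (0, -1)` and `T (0, 1)`. So the reversed return
  -- has the same factor `r`, and combining both returns gives `r² = 1`.
  have h1 := T_zpow_swap a b n (0, 1)
  rw [hrn, show ((0, 1) : ℝ × ℝ).swap = T a b (0, -1) from hT1.symm,
    show (r • ((0, -1) : ℝ × ℝ)).swap = r • T a b (0, 1) by rw [hT2]; rfl,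
    ← T_smul a b hr, ← Equiv.Perm.mul_apply, (Commute.refl (T a b)).zpow_left (-n) |>.eq,
    Equiv.Perm.mul_apply] at h1
  have h2 := congrArg (T a b ^ n) ((T a b).injective h1)
  rw [← Equiv.Perm.mul_apply, ← zpow_add, add_neg_cancel, zpow_zero, Equiv.Perm.one_apply,
    T_zpow_smul a b n hr, hrn, smul_smul] at h2
  have h3 : -1 = r * r * (-1) := by simpa using congrArg Prod.snd h2
  have h4 : r = 1 := by nlinarith
  rw [hrn, h4, one_smul]

/-! ### The cone structure defined by a return from a break to the opposite break -/

/-- The break carried by the `i`-th point of the orbit of `p`. -/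
noncomputable def orbitBreak (a b : ℝ) (p : UnitCircle) (i : ℕ) (t : ℝ) : ℝ :=
  open Classical in
  if turn t = (S a b ^ i) p then (a - b) * (p : ℝ × ℝ).2 * len ((T a b ^ i) p) ^ 2 else 0

theorem T_pow_eq_len_smul (a b : ℝ) (i : ℕ) (p : UnitCircle) :
    (T a b ^ i) p = len ((T a b ^ i) p) • ((S a b ^ i) p : ℝ × ℝ) := by
  obtain ⟨r, hr, h⟩ := exists_T_zpow_eq_smul a b i p
  rw [zpow_natCast, zpow_natCast] at h
  have hl : len ((S a b ^ i) p : ℝ × ℝ) = 1 := by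
    rw [len, ((S a b ^ i) p).2, Real.sqrt_one]
  have : len ((T a b ^ i) p) = r := by rw [h, len_smul hr.le, hl, mul_one]
  rw [this, h]

/-- Pulling the shear at point `i + 1` back through the plane map gives the shear at point `i`: both
have strength `(a - b) p₂` along the unnormalized orbit vectors. -/
theorem orbitBreak_succ_lift {a b : ℝ} {Φ : CircleDeg1Lift} (hΦ : IsAperiodicLift a b Φ)
    (p : UnitCircle) (i : ℕ) (t : ℝ) :
    orbitBreak a b p (i + 1) (Φ t) / len (T a b (unitVec t)) ^ 2 = orbitBreak a b p i t := by
  have hl := len_pos (T_ne_zero a b (unitVec_ne_zero t))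
  have hiff : turn (Φ t) = (S a b ^ (i + 1)) p ↔ turn t = (S a b ^ i) p := by
    rw [← hΦ.lift, pow_succ', Equiv.Perm.mul_apply, (S a b).apply_eq_iff_eq]
  by_cases h : turn t = (S a b ^ i) p
  · rw [orbitBreak, orbitBreak, if_pos (hiff.2 h), if_pos h]
    have h1 := T_pow_eq_len_smul a b i p
    rw [← h] at h1
    have hne : (T a b ^ i) p ≠ 0 := by
      obtain ⟨r, hr, hrp⟩ := exists_T_zpow_eq_smul a b i p
      rw [zpow_natCast] at hrp
      rw [hrp]
      exact smul_ne_zero hr.ne' (UnitCircle.ne_zero _)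
    have h2 : len ((T a b ^ (i + 1)) p) = len ((T a b ^ i) p) * len (T a b (unitVec t)) := by
      rw [pow_succ', Equiv.Perm.mul_apply, h1, T_smul a b (len_pos hne), len_smul (len_nonneg _),
        ← h1]
      rfl
    rw [h2]
    field_simp
  · rw [orbitBreak, orbitBreak, if_neg (mt hiff.1 h), if_neg h, zero_div]

/-- The breaks along an orbit from a break of `T a b` to the opposite one are compatible with
those of `T a b`. -/
theorem sum_orbitBreak_eq {a b : ℝ} {Φ : CircleDeg1Lift} (hΦ : IsAperiodicLift a b Φ)
    {p q : UnitCircle} (hpq : p = north ∧ q = south ∨ p = south ∧ q = north) {n : ℕ}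
    (hS : (S a b ^ n) p = q) (hT : (T a b ^ n) p = q) (t : ℝ) :
    ∑ i ∈ Finset.range n, orbitBreak a b p (i + 1) t =
      breakSize a b t + (∑ i ∈ Finset.range n, orbitBreak a b p (i + 1) (Φ t)) /
        len (T a b (unitVec t)) ^ 2 := by
  simp only [Finset.sum_div, orbitBreak_succ_lift hΦ]
  have htel : ∑ i ∈ Finset.range n, orbitBreak a b p (i + 1) t + orbitBreak a b p 0 t =
      ∑ i ∈ Finset.range n, orbitBreak a b p i t + orbitBreak a b p n t := by
    rw [← Finset.sum_range_succ' (fun i => orbitBreak a b p i t), Finset.sum_range_succ]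
  have hunit : ∀ u : UnitCircle, len (u : ℝ × ℝ) = 1 := fun u => by
    rw [len, u.2, Real.sqrt_one]
  -- After telescoping only the ends of the orbit segment remain; both carry unit vectors, and `q =
  -- -p` gives the opposite signs.
  suffices hb : breakSize a b t = orbitBreak a b p n t - orbitBreak a b p 0 t by
    rw [hb]; linarith
  rw [orbitBreak, orbitBreak, hS, hT, hunit, pow_zero, pow_zero, Equiv.Perm.one_apply,
    Equiv.Perm.one_apply, hunit, breakSize]
  have hns : north ≠ south := by
    intro h
    have := congrArg (fun u : UnitCircle => (u : ℝ × ℝ).2) h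
    norm_num [north, south] at this
  by_cases h : (unitVec t).1 = 0
  · have hnorm : (unitVec t).1 ^ 2 + (unitVec t).2 ^ 2 = 1 := (turn t).2
    rw [h] at hnorm
    rw [if_pos h]
    rcases mul_self_eq_one_iff.1 (show (unitVec t).2 * (unitVec t).2 = 1 by linarith) with h2 | h2
    · have ht : turn t = north := Subtype.ext (Prod.ext h h2)
      rcases hpq with ⟨rfl, rfl⟩ | ⟨rfl, rfl⟩
      · rw [if_neg (by rw [ht]; exact hns), if_pos ht, h2]
        simp [north]
      · rw [if_pos ht, if_neg (by rw [ht]; exact hns), h2]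
        simp [south]
    · have ht : turn t = south := Subtype.ext (Prod.ext h h2)
      rcases hpq with ⟨rfl, rfl⟩ | ⟨rfl, rfl⟩
      · rw [if_pos ht, if_neg (by rw [ht]; exact hns.symm), h2]
        simp [north]
      · rw [if_neg (by rw [ht]; exact hns.symm), if_pos ht, h2]
        simp [south]
  · have hne : ∀ u : UnitCircle, (u : ℝ × ℝ).1 = 0 → turn t ≠ u := by
      rintro u hu rfl
      exact h hu
    rw [if_neg h, if_neg, if_neg, sub_zero]
    · apply hne
      rcases hpq with ⟨rfl, -⟩ | ⟨rfl, -⟩ <;> rfl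
    · apply hne
      rcases hpq with ⟨-, rfl⟩ | ⟨-, rfl⟩ <;> rfl

/-! ### Conic arcs -/

/-- A finite set of directions, not empty, cuts one turn into intervals. -/
theorem exists_angular_partition (D : Finset UnitCircle) {n : ℕ} (hn : 0 < n) (hD : D.card = n) :
    ∃ θ : Fin (n + 1) → ℝ, StrictMono θ ∧ θ (Fin.last n) = θ 0 + 1 ∧
      ∀ i : Fin n, ∀ t ∈ Set.Ioo (θ i.castSucc) (θ i.succ), turn t ∉ D := by
  classical
  obtain ⟨u₀, hu₀⟩ : D.Nonempty := Finset.card_pos.1 (hD ▸ hn)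
  obtain ⟨t₀, rfl⟩ := exists_turn u₀
  have hrep : ∀ u : UnitCircle, ∃ t ∈ Set.Ico t₀ (t₀ + 1), turn t = u := by
    intro u
    obtain ⟨t, rfl⟩ := exists_turn u
    refine ⟨t₀ + Int.fract (t - t₀), ⟨?_, ?_⟩, ?_⟩
    · linarith [Int.fract_nonneg (t - t₀)]
    · linarith [Int.fract_lt_one (t - t₀)]
    · refine turn_eq_turn_iff.2 ⟨⌊t - t₀⌋, ?_⟩
      linarith [Int.fract_add_floor (t - t₀)]
  have huniq : ∀ t ∈ Set.Ico t₀ (t₀ + 1), ∀ t' ∈ Set.Ico t₀ (t₀ + 1), turn t = turn t' →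
      t = t' := by
    intro t ht t' ht' h
    obtain ⟨k, rfl⟩ := turn_eq_turn_iff.1 h
    have h1 : (k : ℝ) < 1 := by linarith [ht.1, ht'.2]
    have h2 : (-1 : ℝ) < k := by linarith [ht.2, ht'.1]
    have h3 : k < 1 := by exact_mod_cast h1
    have h4 : -1 < k := by exact_mod_cast h2
    obtain rfl : k = 0 := by omega
    simp
  choose rep hrep hturn using hrep
  have hinj : Function.Injective rep := Function.LeftInverse.injective hturn
  -- The extra node `t₀ + 1` repeats the first direction and closes the turn, so `n` directions give
  -- `n + 1` nodes.
  set E : Finset ℝ := insert (t₀ + 1) (D.image rep) with hE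
  have hnot : t₀ + 1 ∉ D.image rep := by
    intro h
    obtain ⟨u, -, hu⟩ := Finset.mem_image.1 h
    have := (hrep u).2
    linarith
  have hcard : E.card = n + 1 := by
    rw [hE, Finset.card_insert_of_notMem hnot, Finset.card_image_of_injective _ hinj, hD]
  have hEmem : ∀ x ∈ E, x ∈ Set.Icc t₀ (t₀ + 1) := by
    intro x hx
    rcases Finset.mem_insert.1 hx with rfl | hx
    · exact ⟨by linarith, le_rfl⟩
    · obtain ⟨u, -, rfl⟩ := Finset.mem_image.1 hx
      exact Set.Ico_subset_Icc_self (hrep u)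
  have hrange : ∀ x ∈ E, ∃ j, E.orderEmbOfFin hcard j = x := by
    intro x hx
    have := Finset.range_orderEmbOfFin E hcard
    exact (Set.ext_iff.1 this x).2 hx
  have ht₀ : t₀ ∈ E := by
    refine Finset.mem_insert_of_mem (Finset.mem_image.2 ⟨turn t₀, hu₀, ?_⟩)
    exact huniq _ (hrep _) _ ⟨le_rfl, by linarith⟩ (hturn _)
  have hθ0 : E.orderEmbOfFin hcard 0 = t₀ := by
    obtain ⟨j, hj⟩ := hrange _ ht₀
    refine le_antisymm ?_ (hEmem _ (Finset.orderEmbOfFin_mem E hcard 0)).1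
    rw [← hj]
    exact (E.orderEmbOfFin hcard).monotone (Fin.zero_le j)
  have hθl : E.orderEmbOfFin hcard (Fin.last n) = t₀ + 1 := by
    obtain ⟨j, hj⟩ := hrange (t₀ + 1) (Finset.mem_insert_self _ _)
    refine le_antisymm (hEmem _ (Finset.orderEmbOfFin_mem E hcard _)).2 ?_
    rw [← hj]
    exact (E.orderEmbOfFin hcard).monotone (Fin.le_last j)
  refine ⟨E.orderEmbOfFin hcard, (E.orderEmbOfFin hcard).strictMono, by rw [hθ0, hθl], ?_⟩
  intro i t ht htD
  have h1 := (hEmem _ (Finset.orderEmbOfFin_mem E hcard i.castSucc)).1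
  have h2 := (hEmem _ (Finset.orderEmbOfFin_mem E hcard i.succ)).2
  have htE : t ∈ E := by
    refine Finset.mem_insert_of_mem (Finset.mem_image.2 ⟨turn t, htD, ?_⟩)
    exact huniq _ (hrep _) _ ⟨by linarith [ht.1], by linarith [ht.2]⟩ (hturn _)
  obtain ⟨j, rfl⟩ := hrange t htE
  have h3 := (E.orderEmbOfFin hcard).lt_iff_lt.1 ht.1
  have h4 := (E.orderEmbOfFin hcard).lt_iff_lt.1 ht.2
  rw [Fin.lt_def] at h3 h4
  simp only [Fin.val_castSucc, Fin.val_succ] at h3 h4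
  omega

/-- The type of the conics `q = C > 0`, where `q` is a quadratic form with positive values, in
terms of the discriminant of `q`. -/
noncomputable def conicTypeOfDiscrim (Δ : ℝ) : ConicType :=
  if Δ < 0 then .ellipse else if 0 < Δ then .hyperbola else .line

/-- A path on a level set of a quadratic form runs inside a conic. -/
theorem exists_isConic {α β γ C : ℝ} (hC : 0 < C) {f : ℝ → ℝ × ℝ}
    (hf : ContinuousOn f (Set.Icc 0 1)) (hinj : Set.InjOn f (Set.Icc 0 1))
    (hq : ∀ x ∈ Set.Icc (0 : ℝ) 1, quadForm α β γ (f x) = C) :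
    ∃ K, (conicTypeOfDiscrim (β ^ 2 - 4 * α * γ)).IsConic K ∧ f '' Set.Icc 0 1 ⊆ K := by
  have hsub : f '' Set.Icc 0 1 ⊆ quadric α β γ 0 0 (-C) := by
    rintro _ ⟨x, hx, rfl⟩
    have := hq x hx
    simp only [quadForm] at this
    simp only [quadric, Set.mem_ofPred_eq]
    linarith
  have hmem0 : (0 : ℝ) ∈ Set.Icc (0 : ℝ) 1 := ⟨le_rfl, zero_le_one⟩
  have hmem1 : (1 : ℝ) ∈ Set.Icc (0 : ℝ) 1 := ⟨zero_le_one, le_rfl⟩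
  rcases lt_trichotomy (β ^ 2 - 4 * α * γ) 0 with hΔ | hΔ | hΔ
  · refine ⟨_, ?_, hsub⟩
    rw [conicTypeOfDiscrim, if_pos hΔ]
    refine ⟨α, β, γ, 0, 0, -C, hΔ, rfl, f 0, hsub ⟨0, hmem0, rfl⟩, f 1, hsub ⟨1, hmem1, rfl⟩, ?_⟩
    intro h
    exact zero_ne_one (hinj hmem0 hmem1 h)
  · rw [conicTypeOfDiscrim, hΔ, if_neg (lt_irrefl _), if_neg (lt_irrefl _)]
    -- With zero discriminant and a positive value the form is the square of a linear form;
    -- connectedness of the path then selects one of two parallel lines.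
    obtain ⟨d, e, hde⟩ : ∃ d e : ℝ, ∀ v, quadForm α β γ v = (d * v.1 + e * v.2) ^ 2 := by
      have h0 := hq 0 hmem0
      have hα : 0 ≤ α := by
        by_contra hneg
        push Not at hneg
        have : α * C = (α * (f 0).1 + β / 2 * (f 0).2) ^ 2 := by
          rw [← h0, quadForm]
          linear_combination (-(f 0).2 ^ 2 / 4) * hΔ
        nlinarith [sq_nonneg (α * (f 0).1 + β / 2 * (f 0).2)]
      rcases hα.eq_or_lt with rfl | hα
      · obtain rfl : β = 0 := by
          have : β ^ 2 = 0 := by linarith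
          exact pow_eq_zero_iff two_ne_zero |>.1 this
        have hγ : 0 ≤ γ := by
          by_contra hneg
          push Not at hneg
          simp only [quadForm] at h0
          nlinarith [sq_nonneg (f 0).2]
        refine ⟨0, √γ, fun v => ?_⟩
        rw [quadForm]
        linear_combination (-v.2 ^ 2) * Real.sq_sqrt hγ
      · have hs := Real.sq_sqrt hα.le
        have hs0 := (Real.sqrt_pos.2 hα).ne'
        refine ⟨√α, β / (2 * √α), fun v => ?_⟩
        have h1 : (√α * v.1 + β / (2 * √α) * v.2) ^ 2 =
            (√α) ^ 2 * v.1 ^ 2 + β * v.1 * v.2 + β ^ 2 / (4 * (√α) ^ 2) * v.2 ^ 2 := by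
          field_simp
          ring
        have h2 : β ^ 2 / (4 * α) = γ := by
          rw [div_eq_iff (by positivity)]
          linarith
        rw [h1, hs, h2, quadForm]
    have hnz : d ≠ 0 ∨ e ≠ 0 := by
      by_contra hcon
      push Not at hcon
      have h0 := hq 0 hmem0
      rw [hde, hcon.1, hcon.2] at h0
      norm_num at h0
      exact hC.ne h0
    have hcont : ContinuousOn (fun x => d * (f x).1 + e * (f x).2) (Set.Icc 0 1) :=
      (continuousOn_const.mul (continuous_fst.comp_continuousOn hf)).add
        (continuousOn_const.mul (continuous_snd.comp_continuousOn hf))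
    rcases isPreconnected_Icc.eq_or_eq_neg_of_sq_eq hcont
      (continuousOn_const (c := √C)) (fun x hx => by
        simp only [Pi.pow_apply]
        rw [← hde, hq x hx, Real.sq_sqrt hC.le]) (fun _ => (Real.sqrt_pos.2 hC).ne') with h | h
    · refine ⟨_, ⟨d, e, -√C, hnz, rfl⟩, ?_⟩
      rintro _ ⟨x, hx, rfl⟩
      have := h hx
      simp only [Set.mem_ofPred_eq] at this ⊢
      linarith
    · refine ⟨_, ⟨d, e, √C, hnz, rfl⟩, ?_⟩
      rintro _ ⟨x, hx, rfl⟩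
      have := h hx
      simp only [Set.mem_ofPred_eq, Pi.neg_apply] at this ⊢
      linarith
  · refine ⟨_, ?_, hsub⟩
    rw [conicTypeOfDiscrim, if_neg hΔ.not_gt, if_pos hΔ]
    refine ⟨α, β, γ, 0, 0, -C, hΔ, ?_, rfl⟩
    have : C * (β ^ 2 - 4 * α * γ) ≠ 0 := (mul_pos hC hΔ).ne'
    intro h
    apply this
    linear_combination h

/-- The level sets of a gauge which is quadratic in developing coordinates are made of conic
arcs, all of the same type. -/
theorem IsGauge.isUnionOfConicArcs {a b : ℝ} {N : ℝ × ℝ → ℝ} (h : IsGauge a b N)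
    {σ : ℝ → ℝ} {c : ℝ → ℝ × ℝ} {M : Sp} (hc : IsDeveloping σ c M) {α β γ : ℝ}
    (hN : ∀ t, N (unitVec t) = quadForm α β γ (c t)) {D : Finset UnitCircle} {n : ℕ}
    (hn : 2 ≤ n) (hD : D.card = n) (hσ : ∀ t, turn t ∉ D → σ t = 0) {C : ℝ} (hC : 0 < C) :
    IsUnionOfConicArcs (conicTypeOfDiscrim (β ^ 2 - 4 * α * γ)) n {v | N v = C} := by
  obtain ⟨θ, hθ, hθl, hθD⟩ := exists_angular_partition D (by omega) hD
  have hlt : ∀ i : Fin n, θ i.castSucc < θ i.succ := fun i => hθ i.castSucc_lt_succ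
  have h0le : ∀ j, θ 0 ≤ θ j := fun j => hθ.monotone (Fin.zero_le j)
  have hlel : ∀ j, θ j ≤ θ 0 + 1 := fun j => hθl ▸ hθ.monotone (Fin.le_last j)
  -- Since `n ≥ 2`, no sector fills a whole turn; this makes each arc injective, including its end
  -- points.
  have hshort : ∀ i : Fin n, θ i.succ - θ i.castSucc < 1 := by
    intro i
    by_cases hi : i.castSucc = 0
    · have h1 : θ i.succ < θ (Fin.last n) := by
        apply hθ
        rw [Fin.lt_def, Fin.val_last, Fin.val_succ]
        have := congrArg Fin.val hi
        simp only [Fin.val_castSucc, Fin.val_zero] at this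
        omega
      linarith [h0le i.castSucc]
    · have h1 : θ 0 < θ i.castSucc := hθ (Fin.pos_iff_ne_zero.2 hi)
      linarith [hlel i.succ]
  have hclose : ∀ {t t' : ℝ}, |t' - t| < 1 → turn t = turn t' → t = t' := by
    intro t t' ht htt
    obtain ⟨k, rfl⟩ := turn_eq_turn_iff.1 htt
    rw [add_sub_cancel_left, ← Int.cast_abs] at ht
    have : |k| < 1 := by exact_mod_cast ht
    rw [Int.abs_lt_one_iff] at this
    simp [this]
  set ψ : Fin n → ℝ → ℝ := fun i x => θ i.castSucc + x * (θ i.succ - θ i.castSucc) with hψ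
  have hψIcc : ∀ i, ∀ x ∈ Set.Icc (0 : ℝ) 1, ψ i x ∈ Set.Icc (θ i.castSucc) (θ i.succ) := by
    intro i x hx
    have := hlt i
    constructor <;> simp only [hψ] <;> nlinarith [hx.1, hx.2]
  have hψIoo : ∀ i, ∀ x ∈ Set.Ioo (0 : ℝ) 1, ψ i x ∈ Set.Ioo (θ i.castSucc) (θ i.succ) := by
    intro i x hx
    have := hlt i
    constructor <;> simp only [hψ] <;> nlinarith [hx.1, hx.2]
  have hψsurj : ∀ i, ∀ t ∈ Set.Icc (θ i.castSucc) (θ i.succ), ∃ x ∈ Set.Icc (0 : ℝ) 1,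
      ψ i x = t := by
    intro i t ht
    have hpos : 0 < θ i.succ - θ i.castSucc := sub_pos.2 (hlt i)
    refine ⟨(t - θ i.castSucc) / (θ i.succ - θ i.castSucc), ⟨?_, ?_⟩, ?_⟩
    · exact div_nonneg (sub_nonneg.2 ht.1) hpos.le
    · rw [div_le_one hpos]
      linarith [ht.2]
    · simp only [hψ]
      rw [div_mul_cancel₀ _ hpos.ne']
      ring
  have hcont : ∀ i, Continuous fun x => levelCurve N C (ψ i x) := by
    intro i
    refine (h.continuous_levelCurve C).comp ?_
    simp only [hψ]
    fun_prop
  have hinj : ∀ i, Set.InjOn (fun x => levelCurve N C (ψ i x)) (Set.Icc 0 1) := by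
    intro i x hx y hy hxy
    have h1 := hψIcc i x hx
    have h2 := hψIcc i y hy
    have h3 := hclose (by rw [abs_lt]; constructor <;> linarith [hshort i, h1.1, h1.2, h2.1, h2.2])
      ((h.levelCurve_eq_iff hC).1 hxy)
    simp only [hψ, add_right_inj] at h3
    exact mul_right_cancel₀ (sub_pos.2 (hlt i)).ne' h3
  refine ⟨fun i x => levelCurve N C (ψ i x), fun i => ⟨(hcont i).continuousOn, hinj i, ?_⟩,
    fun i j hij => ?_, ?_⟩
  -- There is no break inside the sector, so there `N` is the quadratic form `q ∘ B`, with the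
  -- discriminant of `q`.
  · obtain ⟨B, hB⟩ := hc.exists_eqOn_Icc (hlt i) fun t ht => hσ t (hθD i t ht)
    obtain ⟨α', β', γ', hΔ, hq⟩ := exists_quadForm_smul α β γ B
    rw [← hΔ]
    refine exists_isConic hC (hcont i).continuousOn (hinj i) fun x hx => ?_
    have hp := h.pos _ (unitVec_ne_zero (ψ i x))
    change quadForm α' β' γ' (levelCurve N C (ψ i x)) = C
    rw [levelCurve, quadForm_smul, ← hq, ← hB _ (hψIcc i x hx), ← hN,
      Real.sq_sqrt (by positivity)]
    field_simp
  · rw [Set.disjoint_left]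
    rintro _ ⟨x, hx, rfl⟩ ⟨y, hy, hxy⟩
    have h1 := hψIoo i x hx
    have h2 := hψIcc j y hy
    have h3 := hclose (by
      rw [abs_lt]
      constructor <;> linarith [h0le i.castSucc, hlel i.succ, h0le j.castSucc, hlel j.succ,
        h1.1, h1.2, h2.1, h2.2]) ((h.levelCurve_eq_iff hC).1 hxy)
    rw [h3] at h2
    have h4 := hθ.lt_iff_lt.1 (h1.1.trans_le h2.2)
    have h5 := hθ.lt_iff_lt.1 (h2.1.trans_lt h1.2)
    rw [Fin.lt_def] at h4 h5
    simp only [Fin.val_castSucc, Fin.val_succ] at h4 h5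
    exact hij (Fin.ext (by omega))
  · rw [← h.range_levelCurve hC]
    apply Set.Subset.antisymm
    · rintro _ ⟨t', rfl⟩
      obtain ⟨t, ht0, ht1, htt⟩ : ∃ t, θ 0 ≤ t ∧ t ≤ θ 0 + 1 ∧ turn t' = turn t := by
        refine ⟨θ 0 + Int.fract (t' - θ 0), ?_, ?_, ?_⟩
        · linarith [Int.fract_nonneg (t' - θ 0)]
        · linarith [Int.fract_lt_one (t' - θ 0)]
        · refine (turn_eq_turn_iff.2 ⟨⌊t' - θ 0⌋, ?_⟩).symm
          linarith [Int.fract_add_floor (t' - θ 0)]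
      rw [(h.levelCurve_eq_iff hC).2 htt]
      obtain ⟨i, hi⟩ : ∃ i : Fin n, t ∈ Set.Icc (θ i.castSucc) (θ i.succ) := by
        by_contra hcon
        push Not at hcon
        have hall : ∀ j, θ j ≤ t := by
          intro j
          induction j using Fin.induction with
          | zero => exact ht0
          | succ i ih =>
            by_contra hlt'
            exact hcon i ⟨ih, (not_le.1 hlt').le⟩
        refine hcon ⟨n - 1, by omega⟩ ⟨hall _, ?_⟩
        have : (⟨n - 1, by omega⟩ : Fin n).succ = Fin.last n := by
          ext
          simp only [Fin.val_succ, Fin.val_last]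
          omega
        rw [this, hθl]
        exact ht1
      obtain ⟨x, hx, rfl⟩ := hψsurj i t hi
      exact Set.mem_iUnion.2 ⟨i, x, hx, rfl⟩
    · refine Set.iUnion_subset fun i => ?_
      rintro _ ⟨x, -, rfl⟩
      exact ⟨_, rfl⟩

/-- The structure of the orbit closures when the orbit of a break contains the opposite one. -/
theorem exists_gauge_of_return {a b : ℝ} {Φ : CircleDeg1Lift} (hΦ : IsAperiodicLift a b Φ)
    {p q : UnitCircle} (hpq : p = north ∧ q = south ∨ p = south ∧ q = north) {n : ℕ}
    (hS : (S a b ^ n) p = q) (hT : (T a b ^ n) p = q) :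
    ∃ N : ℝ × ℝ → ℝ, IsGauge a b N ∧ ∃ τ : ConicType, ∀ C : ℝ, 0 < C →
      IsUnionOfConicArcs τ n {v | N v = C} := by
  classical
  obtain ⟨c, M, hc⟩ := exists_isDeveloping (Finset.range n) (fun i => (S a b ^ (i + 1)) p)
    (fun i => (a - b) * (p : ℝ × ℝ).2 * len ((T a b ^ (i + 1)) p) ^ 2)
  have hc' : IsDeveloping (fun t => ∑ i ∈ Finset.range n, orbitBreak a b p (i + 1) t) c M := by
    convert hc using 4
    unfold orbitBreak
    congr
  obtain ⟨N, α, β, γ, hN, hNc⟩ := hc'.exists_isGauge hΦ (sum_orbitBreak_eq hΦ hpq hS hT)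
  refine ⟨N, hN, conicTypeOfDiscrim (β ^ 2 - 4 * α * γ), fun C hC => ?_⟩
  -- Neither zero nor one step leads from a pole to the opposite pole, since the image of a pole is
  -- horizontal.
  have hn : 2 ≤ n := by
    have hn0 : n ≠ 0 := by
      rintro rfl
      have h2 := congrArg Prod.snd hT
      rcases hpq with ⟨rfl, rfl⟩ | ⟨rfl, rfl⟩ <;> norm_num [north, south] at h2
    have hn1 : n ≠ 1 := by
      rintro rfl
      have h2 := congrArg Prod.fst hT
      rcases hpq with ⟨rfl, rfl⟩ | ⟨rfl, rfl⟩ <;> norm_num [north, south, T] at h2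
    omega
  have hinj : Function.Injective fun i : ℕ => (S a b ^ (i + 1)) p := by
    intro i j hij
    have h1 : (S a b ^ ((i + 1 : ℕ) : ℤ)) p = (S a b ^ ((j + 1 : ℕ) : ℤ)) p := by
      rw [zpow_natCast, zpow_natCast]
      exact hij
    have := hΦ.zpow_apply_injective p h1
    omega
  refine hN.isUnionOfConicArcs hc' hNc (D := (Finset.range n).image fun i => (S a b ^ (i + 1)) p)
    hn ?_ ?_ hC
  · rw [Finset.card_image_of_injective _ hinj, Finset.card_range]
  · intro t ht
    refine Finset.sum_eq_zero fun i hi => ?_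
    rw [orbitBreak, if_neg]
    intro h
    exact ht (Finset.mem_image.2 ⟨i, hi, h.symm⟩)

end PlaneMap

/-! ### The main theorem: return times of either sign -/

theorem mainTheorem1 (a b r : ℝ)
    (hr : PlaneMap.HasRotationNumber (PlaneMap.S a b) r) (hirr : Irrational r)
    (horb : ∃ n : ℤ, (PlaneMap.S a b ^ n) PlaneMap.north = PlaneMap.south) :
    ((0, -1) : ℝ × ℝ) ∈ PlaneMap.orbit (PlaneMap.T a b) (0, 1) ∧
    (∀ v : ℝ × ℝ, v ≠ 0 →
      PlaneMap.IsInvariantCircle (PlaneMap.T a b)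
        (closure (PlaneMap.orbit (PlaneMap.T a b) v))) ∧
    ∃ τ : PlaneMap.ConicType, ∀ v : ℝ × ℝ, v ≠ 0 →
      ∀ n : ℤ, (PlaneMap.S a b ^ n) PlaneMap.north = PlaneMap.south →
        ∃ m : ℕ, m ≤ n.natAbs ∧
          PlaneMap.IsUnionOfConicArcs τ m
            (closure (PlaneMap.orbit (PlaneMap.T a b) v)) := by
  obtain ⟨Φ, hΦc, hΦl, rfl⟩ := hr
  have hΦ := PlaneMap.isAperiodicLift_of_irrational hΦc hΦl hirr
  obtain ⟨n, hn⟩ := horb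
  have hT := PlaneMap.T_zpow_north hn
  obtain ⟨N, hN, τ, hτ⟩ : ∃ N : ℝ × ℝ → ℝ, PlaneMap.IsGauge a b N ∧
      ∃ τ : PlaneMap.ConicType, ∀ C : ℝ, 0 < C →
        PlaneMap.IsUnionOfConicArcs τ n.natAbs {v | N v = C} := by
    obtain ⟨k, rfl | rfl⟩ := n.eq_nat_or_neg
    · rw [Int.natAbs_natCast]
      rw [zpow_natCast] at hn hT
      exact PlaneMap.exists_gauge_of_return hΦ (Or.inl ⟨rfl, rfl⟩) hn hT
    -- For a negative return time the orbit segment is run forwards from south to north.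
    · rw [Int.natAbs_neg, Int.natAbs_natCast]
      rw [zpow_neg, zpow_natCast, Equiv.Perm.inv_eq_iff_eq] at hn hT
      exact PlaneMap.exists_gauge_of_return hΦ (Or.inr ⟨rfl, rfl⟩) hn.symm hT.symm
  refine ⟨⟨n, hT⟩, fun v hv => ?_, τ, fun v hv n' hn' => ⟨n.natAbs, ?_, ?_⟩⟩
  · rw [hN.closure_orbit hΦ hv]
    exact hN.isInvariantCircle (hN.pos v hv)
  -- Without periodic points the return time is unique, so `n' = n`.
  · rw [hΦ.zpow_apply_injective PlaneMap.north (hn'.trans hn.symm)]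
  · rw [hN.closure_orbit hΦ hv]
    exact hτ _ (hN.pos v hv)
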